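/- Let $\beta>0$ and $\gamma\ge 0$. For each integer $N\ge 1$ let $\vec Y=(Y_1,\dots,Y_N)\in[0,1]^N$ be a random vector with density $$f_{\vec Y}(\vec y)=\frac1{Z_N}\exp\Big(-\sum_{i=1}^N\Big(\frac{\beta}{2y_i}+\frac{\gamma}{y_i+y_{i+1}}\Big)\Big),\qquad Z_N=\int_{[0,1]^N}\exp\Big(-\sum_{i=1}^N\Big(\frac{\beta}{2y_i}+\frac{\gamma}{y_i+y_{i+1}}\Big)\Big)\,d\vec y,$$ on $[0,1]^N$, where indices are taken modulo $N$ (so $y_{N+1}=y_1$). Put $$\sigma_N^2=\frac1N\operatorname{Var}\Big(\sum_{i=1}^N\big(Y_i-\mathbb E(Y_i)\big)\Big),\qquad \zeta_N=\frac1{\sqrt{N\sigma_N^2}}\sum_{i=1}^N\big(Y_i-\mathbb E(Y_i)\big).$$ Then $\sigma_N^2>0$ for every $N\ge 1$ (so $\zeta_N$ is well defined), and for every $\epsilon\in(0,1/4)$, $$\sup_{z\in\mathbb R}\big|\mathbb P(\zeta_N\le z)-\mathbb P(Z\le z)\big|=O\big(N^{-\frac14+\epsilon}\big)\qquad(N\to\infty),$$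 where $Z$ is a standard normal random variable and the implied constant depends only on $\beta,\gamma,\epsilon$. -/

import Mathlib

open MeasureTheory ProbabilityTheory

noncomputable section

namespace CoulombChain

/-- The energy `∑ᵢ (β / (2 yᵢ) + γ / (yᵢ + yᵢ₊₁))` of the circular chain with spacings `y`.
Addition in `Fin N` is modulo `N`, so the last spacing is followed by the first one. -/
def energy (β γ : ℝ) (N : ℕ) [NeZero N] (y : Fin N → ℝ) : ℝ :=
  ∑ i : Fin N, (β / (2 * y i) + γ / (y i + y (i + 1)))

/-- The normalising constant, the integral of `exp (-energy)` over the cube `[0,1]^N`. -/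
def partitionFunction (β γ : ℝ) (N : ℕ) [NeZero N] : ℝ :=
  ∫ y in Set.Icc (0 : Fin N → ℝ) 1, Real.exp (-energy β γ N y)

/-- The density `exp (-energy) / Z` on the cube `[0,1]^N`. (The value on the faces `yᵢ = 0`, a
Lebesgue null set, is immaterial.) -/
def density (β γ : ℝ) (N : ℕ) [NeZero N] (y : Fin N → ℝ) : ℝ :=
  1 / partitionFunction β γ N * Real.exp (-energy β γ N y)

/-- The Gibbs law on `ℝ^N`: it lives on the cube `[0,1]^N` and has density `density` with respect
to Lebesgue measure there. -/
def law (β γ : ℝ) (N : ℕ) [NeZero N] : Measure (Fin N → ℝ) :=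
  (volume.restrict (Set.Icc (0 : Fin N → ℝ) 1)).withDensity
    fun y => ENNReal.ofReal (density β γ N y)

section Sums

variable {Ω : Type*} [MeasurableSpace Ω] {N : ℕ}

/-- The centred sum `∑ᵢ (Yᵢ - E Yᵢ)`. -/
def centredSum (P : Measure Ω) (Y : Ω → Fin N → ℝ) (ω : Ω) : ℝ :=
  ∑ i : Fin N, (Y ω i - ∫ ω', Y ω' i ∂P)

/-- `σ_N² = N⁻¹ Var (∑ᵢ (Yᵢ - E Yᵢ))`. -/
def sigmaSq (P : Measure Ω) (Y : Ω → Fin N → ℝ) : ℝ :=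
  1 / (N : ℝ) * variance (centredSum P Y) P

/-- `ζ_N = (N σ_N²)^(-1/2) ∑ᵢ (Yᵢ - E Yᵢ)`. -/
def zeta (P : Measure Ω) (Y : Ω → Fin N → ℝ) (ω : Ω) : ℝ :=
  1 / Real.sqrt ((N : ℝ) * sigmaSq P Y) * centredSum P Y ω

end Sums

/-- The Gibbs law is a probability measure. -/
theorem isProbabilityMeasure_law {β γ : ℝ} (hβ : 0 < β) (hγ : 0 ≤ γ) (N : ℕ) [NeZero N] :
    IsProbabilityMeasure (law β γ N) := by
  have hm : Measurable (fun y : Fin N → ℝ => Real.exp (-energy β γ N y)) := by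
    unfold energy; fun_prop
  have hI : Integrable (fun y : Fin N → ℝ => Real.exp (-energy β γ N y))
      (volume.restrict (Set.Icc (0 : Fin N → ℝ) 1)) := by
    have hfin : IsFiniteMeasure ((volume : Measure (Fin N → ℝ)).restrict
        (Set.Icc (0 : Fin N → ℝ) 1)) := ⟨by
      rw [Measure.restrict_apply_univ]; exact isCompact_Icc.measure_lt_top⟩
    refine Integrable.of_bound hm.aestronglyMeasurable 1 ?_
    refine (ae_restrict_iff' measurableSet_Icc).2 (Filter.Eventually.of_forall fun y hy => ?_)
    rw [Real.norm_eq_abs, abs_of_pos (Real.exp_pos _), Real.exp_le_one_iff, neg_nonpos]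
    refine Finset.sum_nonneg fun i _ => ?_
    have h1 : 0 ≤ y i := hy.1 i
    have h2 : 0 ≤ y (i + 1) := hy.1 (i + 1)
    positivity
  have hZ : 0 < partitionFunction β γ N := by
    unfold partitionFunction
    rw [integral_pos_iff_support_of_nonneg (fun y => (Real.exp_pos _).le) hI]
    have hs : Function.support (fun y : Fin N → ℝ => Real.exp (-energy β γ N y)) = Set.univ := by
      ext y; simp [Real.exp_ne_zero]
    rw [hs, Measure.restrict_apply_univ, Real.volume_Icc_pi]
    simp
  refine ⟨?_⟩
  unfold law
  rw [withDensity_apply _ MeasurableSet.univ, Measure.restrict_univ,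
    ← ofReal_integral_eq_lintegral_ofReal]
  · simp only [density]
    rw [integral_const_mul]
    change ENNReal.ofReal (1 / partitionFunction β γ N * partitionFunction β γ N) = 1
    rw [one_div, inv_mul_cancel₀ hZ.ne', ENNReal.ofReal_one]
  · exact hI.const_mul _
  · exact Filter.Eventually.of_forall fun y => by unfold density; positivity

end CoulombChain

end

/-!
The rate comes from Stein's method with local windows, fed by the exponential decay of correlations
of the chain.

*Decay of correlations.* The bond weight `exp (-γ / (x + y))` tends to `0` at the corner, so the
one-step kernel is not bounded below. It is, however, at most `1` and at least `exp (-γ / x)` and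
`exp (-γ / y)`, so after integration over an intermediate site the two-step kernel lies between two
positive constants. Around an arc `A` of the cycle, two layers of sites thus act as a Doeblin
condition: the conditional expectation of an observable of `A`, as a function of the configuration
outside, has its range contracted by a fixed factor each time the arc is enlarged by two sites at
both ends (`Model.CondBetween.step`), and `Model.abs_avg_mul_sub_le` follows. Conditional
expectations are handled without conditional measures, as quotients of partial integrals `marg`
over a product probability measure.

*Variance.* For each site `d` there is a bounded function `score d` of the spins at `d` and its
neighbours which has conditional mean zero given the spins other than the `d`-th one, and whose
covariance with the `d`-th spin is at least a constant. The Cauchy–Schwarz inequality against the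
sum of the scores bounds the variance of the sum of the spins below by a multiple of `N`, for every
`N ≥ 1` (`Model.le_avg_sq`). In particular `σ_N² > 0`.

*Normal approximation.* If `f' - x f = h - E h(Z)`, then `E h(ζ) - E h(Z) = E (f'(ζ) - ζ f(ζ))`.
For a smooth step `h` of width `δ` the functions `f` and `f'` are bounded uniformly in `δ`, and `f'`
has Lipschitz constant `O(1 / δ)` (`exists_stein_solution`; the bounds on `f` come from a barrier
argument, and those on `f'` from the fact that it solves an equation of the same type). Expanding
`f` around the sum without a window of `k` sites leaves a remainder of order `k² / (δ √N)`, a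
variance term of order `k^(3/2) / √N`, and correlations that are exponentially small in `k`
(`abs_stein_discrepancy_le`). The smoothing costs `δ` (`exists_kolmogorov_le`). With `k ≈ N ^ ε` and
`δ = N ^ (-1/4 + ε)` the total is `O(N ^ (-1/4 + ε))`.
-/

noncomputable section

set_option linter.unusedSectionVars false

namespace CoulombChain

/-! ### Bounded observables and partial integration over a product measure -/

section Bounded

variable {Ω : Type*} [MeasurableSpace Ω]

/-- Bounded measurable real functions: the class of observables for which every integral below
exists. -/
def IsBdd (φ : Ω → ℝ) : Prop :=
  Measurable φ ∧ ∃ C, ∀ y, |φ y| ≤ C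

theorem IsBdd.of_le {φ : Ω → ℝ} (h : Measurable φ) {C : ℝ} (hC : ∀ y, |φ y| ≤ C) : IsBdd φ :=
  ⟨h, C, hC⟩

theorem isBdd_of_unit {v : Ω → ℝ} (hv : Measurable v) (h0 : ∀ x, 0 ≤ v x) (h1 : ∀ x, v x ≤ 1) :
    IsBdd v :=
  IsBdd.of_le hv (C := 1) fun x => by rw [abs_of_nonneg (h0 x)]; exact h1 x

theorem isBdd_const (c : ℝ) : IsBdd (fun _ : Ω => c) :=
  ⟨measurable_const, |c|, fun _ => le_rfl⟩

theorem IsBdd.integrable {φ : Ω → ℝ} (h : IsBdd φ) (μ : Measure Ω) [IsFiniteMeasure μ] :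
    Integrable φ μ := by
  obtain ⟨hm, C, hC⟩ := h
  exact Integrable.of_bound hm.aestronglyMeasurable C (Filter.Eventually.of_forall hC)

theorem IsBdd.add {φ ψ : Ω → ℝ} (h : IsBdd φ) (h' : IsBdd ψ) : IsBdd (fun y => φ y + ψ y) := by
  obtain ⟨hm, C, hC⟩ := h
  obtain ⟨hm', C', hC'⟩ := h'
  exact ⟨hm.add hm', C + C', fun y => (abs_add_le _ _).trans (add_le_add (hC y) (hC' y))⟩

theorem IsBdd.mul {φ ψ : Ω → ℝ} (h : IsBdd φ) (h' : IsBdd ψ) : IsBdd (fun y => φ y * ψ y) := by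
  obtain ⟨hm, C, hC⟩ := h
  obtain ⟨hm', C', hC'⟩ := h'
  refine ⟨hm.mul hm', C * C', fun y => ?_⟩
  rw [abs_mul]
  exact mul_le_mul (hC y) (hC' y) (abs_nonneg _) ((abs_nonneg _).trans (hC y))

theorem IsBdd.const_mul {φ : Ω → ℝ} (h : IsBdd φ) (c : ℝ) : IsBdd (fun y => c * φ y) :=
  (isBdd_const c).mul h

theorem IsBdd.sub {φ ψ : Ω → ℝ} (h : IsBdd φ) (h' : IsBdd ψ) : IsBdd (fun y => φ y - ψ y) := by
  simpa [sub_eq_add_neg] using h.add (h'.const_mul (-1))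

theorem IsBdd.sum {κ : Type*} {φ : κ → Ω → ℝ} (s : Finset κ) (h : ∀ i ∈ s, IsBdd (φ i)) :
    IsBdd (fun y => ∑ i ∈ s, φ i y) := by
  classical
  induction s using Finset.induction_on with
  | empty => simpa using isBdd_const (0 : ℝ)
  | insert a s ha ih =>
    simp only [Finset.sum_insert ha]
    exact (h a (by simp)).add (ih fun i hi => h i (by simp [hi]))

theorem IsBdd.prod {κ : Type*} {φ : κ → Ω → ℝ} (s : Finset κ) (h : ∀ i ∈ s, IsBdd (φ i)) :
    IsBdd (fun y => ∏ i ∈ s, φ i y) := by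
  classical
  induction s using Finset.induction_on with
  | empty => simpa using isBdd_const (1 : ℝ)
  | insert a s ha ih =>
    simp only [Finset.prod_insert ha]
    exact (h a (by simp)).mul (ih fun i hi => h i (by simp [hi]))

end Bounded

section Marginal

variable {ι X : Type*} [Fintype ι] [DecidableEq ι] [MeasurableSpace X]

theorem measurable_piecewise_pair (s : Finset ι) :
    Measurable (fun p : (ι → X) × (ι → X) => s.piecewise p.1 p.2) := by
  refine measurable_pi_iff.2 fun i => ?_
  by_cases hi : i ∈ s
  · simp only [Finset.piecewise_eq_of_mem _ _ _ hi]
    exact (measurable_pi_apply i).comp measurable_fst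
  · simp only [Finset.piecewise_eq_of_notMem _ _ _ hi]
    exact (measurable_pi_apply i).comp measurable_snd

/-- Resampling the coordinates in `s` from an independent copy preserves a product probability
measure. -/
theorem measurePreserving_piecewise (ν : Measure X) [IsProbabilityMeasure ν] (s : Finset ι) :
    MeasurePreserving (fun p : (ι → X) × (ι → X) => s.piecewise p.1 p.2)
      ((Measure.pi fun _ => ν).prod (Measure.pi fun _ => ν)) (Measure.pi fun _ => ν) := by
  refine ⟨measurable_piecewise_pair s, ?_⟩
  symm
  refine Measure.pi_eq fun B hB => ?_
  rw [Measure.map_apply (measurable_piecewise_pair s) (MeasurableSet.univ_pi hB)]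
  have : (fun p : (ι → X) × (ι → X) => s.piecewise p.1 p.2) ⁻¹' (Set.univ.pi B)
      = (Set.univ.pi fun i => if i ∈ s then B i else Set.univ) ×ˢ
        (Set.univ.pi fun i => if i ∈ s then Set.univ else B i) := by
    ext p
    simp only [Set.mem_preimage, Set.mem_univ_pi, Set.mem_prod, ← forall_and]
    refine forall_congr' fun i => ?_
    by_cases hi : i ∈ s <;> simp [hi]
  rw [this, Measure.prod_prod, Measure.pi_pi, Measure.pi_pi, ← Finset.prod_mul_distrib]
  refine Finset.prod_congr rfl fun i _ => ?_
  by_cases hi : i ∈ s <;> simp [hi]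

/-- Integration over the coordinates in `s`, the others being frozen at `y`. All coordinates of
the integration variable `z` are integrated; those outside `s` are ignored, which is harmless
because `ν` is a probability measure. -/
def marg (ν : Measure X) (s : Finset ι) (φ : (ι → X) → ℝ) (y : ι → X) : ℝ :=
  ∫ z, φ (s.piecewise z y) ∂(Measure.pi fun _ => ν)

variable {ν : Measure X} [IsProbabilityMeasure ν] {s t : Finset ι} {φ ψ : (ι → X) → ℝ}

theorem IsBdd.piecewise_left (h : IsBdd φ) (s : Finset ι) (y : ι → X) :
    IsBdd (fun z => φ (s.piecewise z y)) := by
  obtain ⟨hm, C, hC⟩ := h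
  exact ⟨hm.comp ((measurable_piecewise_pair s).comp (measurable_id.prodMk measurable_const)), C,
    fun _ => hC _⟩

theorem IsBdd.marg (h : IsBdd φ) (ν : Measure X) [IsProbabilityMeasure ν] (s : Finset ι) :
    IsBdd (marg ν s φ) := by
  obtain ⟨hm, C, hC⟩ := h
  refine ⟨?_, C, fun y => ?_⟩
  · have h1 : Measurable (fun p : (ι → X) × (ι → X) => φ (s.piecewise p.2 p.1)) :=
      hm.comp ((measurable_piecewise_pair s).comp measurable_swap)
    exact (h1.stronglyMeasurable.integral_prod_right (ν := Measure.pi fun _ => ν)).measurable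
  · have := norm_integral_le_of_norm_le_const (μ := Measure.pi fun _ : ι => ν)
      (f := fun z => φ (s.piecewise z y)) (C := C) (Filter.Eventually.of_forall fun _ => hC _)
    simpa [CoulombChain.marg] using this

theorem integral_marg (h : IsBdd φ) :
    ∫ y, marg ν s φ y ∂(Measure.pi fun _ => ν) = ∫ y, φ y ∂(Measure.pi fun _ => ν) := by
  have hp := measurePreserving_piecewise (ι := ι) ν s
  have h1 : Integrable (fun p : (ι → X) × (ι → X) => φ (s.piecewise p.1 p.2))
      ((Measure.pi fun _ => ν).prod (Measure.pi fun _ => ν)) :=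
    hp.integrable_comp_of_integrable (h.integrable _)
  have h2 := integral_prod_symm _ h1
  rw [show (∫ y, marg ν s φ y ∂(Measure.pi fun _ => ν))
      = ∫ y, ∫ z, φ (s.piecewise z y) ∂(Measure.pi fun _ => ν) ∂(Measure.pi fun _ => ν) from rfl,
    ← h2]
  conv_rhs => rw [← hp.map_eq]
  rw [integral_map hp.measurable.aemeasurable h.1.aestronglyMeasurable]

theorem marg_marg (h : IsBdd φ) (y : ι → X) :
    marg ν s (marg ν t φ) y = marg ν (s ∪ t) φ y := by
  have h' := h.piecewise_left (s ∪ t) y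
  have h3 := integral_marg (ν := ν) (s := t) h'
  unfold marg at h3 ⊢
  rw [← h3]
  refine integral_congr_ae (Filter.Eventually.of_forall fun z => ?_)
  refine integral_congr_ae (Filter.Eventually.of_forall fun z' => ?_)
  refine congrArg φ (funext fun i => ?_)
  by_cases hi : i ∈ s <;> by_cases hj : i ∈ t <;> simp [Finset.piecewise, hi, hj]

theorem dependsOn_marg {u : Set ι} (h : DependsOn φ u) : DependsOn (marg ν s φ) (u \ s) := by
  intro x y hxy
  unfold marg
  refine integral_congr_ae (Filter.Eventually.of_forall fun z => ?_)
  refine h fun i hi => ?_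
  by_cases his : i ∈ s
  · simp [his]
  · simpa [his] using hxy i ⟨hi, by simpa using his⟩

theorem dependsOn_piecewise_eq {u : Set ι} (h : DependsOn ψ u) (hu : Disjoint u (s : Set ι))
    (z y : ι → X) : ψ (s.piecewise z y) = ψ y := by
  refine h fun i hi => ?_
  have : i ∉ s := fun his => Set.disjoint_left.1 hu hi his
  simp [this]

theorem marg_mul_left {u : Set ι} (h : DependsOn ψ u) (hu : Disjoint u (s : Set ι)) (y : ι → X) :
    marg ν s (fun y => ψ y * φ y) y = ψ y * marg ν s φ y := by
  unfold marg
  rw [← integral_const_mul]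
  refine integral_congr_ae (Filter.Eventually.of_forall fun z => ?_)
  simp only [dependsOn_piecewise_eq h hu]

theorem marg_mul_right {u : Set ι} (h : DependsOn ψ u) (hu : Disjoint u (s : Set ι)) (y : ι → X) :
    marg ν s (fun y => φ y * ψ y) y = marg ν s φ y * ψ y := by
  simp only [mul_comm _ (ψ _)]
  exact marg_mul_left h hu y

theorem marg_mono (hφ : IsBdd φ) (hψ : IsBdd ψ) (h : ∀ y, φ y ≤ ψ y) (y : ι → X) :
    marg ν s φ y ≤ marg ν s ψ y :=
  integral_mono ((hφ.piecewise_left s y).integrable _) ((hψ.piecewise_left s y).integrable _)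
    fun _ => h _

theorem marg_sub (hφ : IsBdd φ) (hψ : IsBdd ψ) (y : ι → X) :
    marg ν s (fun y => φ y - ψ y) y = marg ν s φ y - marg ν s ψ y :=
  integral_sub ((hφ.piecewise_left s y).integrable _) ((hψ.piecewise_left s y).integrable _)

theorem marg_const_mul (c : ℝ) (y : ι → X) :
    marg ν s (fun y => c * φ y) y = c * marg ν s φ y :=
  integral_const_mul _ _

end Marginal

theorem dependsOn_mul {ι X : Type*} {φ ψ : (ι → X) → ℝ} {u v : Set ι} (h : DependsOn φ u)
    (h' : DependsOn ψ v) : DependsOn (fun y => φ y * ψ y) (u ∪ v) := fun x y hxy => by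
  simp only [h fun i hi => hxy i (Or.inl hi), h' fun i hi => hxy i (Or.inr hi)]

/-! ### Gibbs weights on a cycle and the Doeblin contraction -/

section Marginal

variable {ι X : Type*} [Fintype ι] [DecidableEq ι] [MeasurableSpace X] {ν : Measure X}
  [IsProbabilityMeasure ν] {φ : (ι → X) → ℝ}

theorem integral_pos_of_pos {Ω : Type*} [MeasurableSpace Ω] {μ : Measure Ω}
    [IsProbabilityMeasure μ] {f : Ω → ℝ} (hf : Integrable f μ) (h : ∀ x, 0 < f x) :
    0 < ∫ x, f x ∂μ := by
  rw [integral_pos_iff_support_of_nonneg (fun x => (h x).le) hf]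
  have : Function.support f = Set.univ := by ext x; simp [(h x).ne']
  simp [this]

theorem marg_pos (hφ : IsBdd φ) (h : ∀ y, 0 < φ y) (s : Finset ι) (y : ι → X) :
    0 < marg ν s φ y :=
  integral_pos_of_pos ((hφ.piecewise_left s y).integrable _) fun _ => h _

end Marginal

/-- A nearest-neighbour Gibbs weight: a probability measure `ν` on the one-site space, a site
weight `site ∈ (0,1]` and a bond weight `bond ∈ (0,1]`. The bond weight need not be bounded below,
but it is at least `floor` of either endpoint, whatever the other endpoint is. -/
structure Model (X : Type*) [MeasurableSpace X] where
  /-- the one-site reference measure -/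
  ν : Measure X
  prob : IsProbabilityMeasure ν
  /-- the one-site weight -/
  site : X → ℝ
  /-- the weight of a pair of neighbours -/
  bond : X → X → ℝ
  /-- a lower bound for the bond weight in terms of one endpoint -/
  floor : X → ℝ
  measurable_site : Measurable site
  measurable_bond : Measurable (Function.uncurry bond)
  measurable_floor : Measurable floor
  site_pos : ∀ x, 0 < site x
  site_le : ∀ x, site x ≤ 1
  floor_pos : ∀ x, 0 < floor x
  floor_le : ∀ x, floor x ≤ 1
  bond_le : ∀ x y, bond x y ≤ 1
  floor_le_left : ∀ x y, floor x ≤ bond x y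
  floor_le_right : ∀ x y, floor y ≤ bond x y

/-- The bonds of the cycle `Fin N` with an endpoint in `D`; the bond `e` joins `e` and `e + 1`. -/
def touch {N : ℕ} [NeZero N] (D : Finset (Fin N)) : Finset (Fin N) :=
  Finset.univ.filter fun e => e ∈ D ∨ e + 1 ∈ D

namespace Model

attribute [instance] Model.prob

variable {X : Type*} [MeasurableSpace X] (M : Model X) {N : ℕ} [NeZero N]

theorem bond_pos (x y : X) : 0 < M.bond x y := (M.floor_pos x).trans_le (M.floor_le_left x y)

/-- The product reference measure on configurations. -/
abbrev ref (N : ℕ) : Measure (Fin N → X) := Measure.pi fun _ => M.ν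

/-- The product of the site weights over `D`. -/
def siteProd (D : Finset (Fin N)) (y : Fin N → X) : ℝ := ∏ i ∈ D, M.site (y i)

/-- The product of the bond weights over `T`. -/
def bondProd (T : Finset (Fin N)) (y : Fin N → X) : ℝ := ∏ e ∈ T, M.bond (y e) (y (e + 1))

/-- The part of the Gibbs weight that involves the sites of `D`. -/
def wt (D : Finset (Fin N)) (y : Fin N → X) : ℝ := M.siteProd D y * M.bondProd (touch D) y

variable (D T : Finset (Fin N)) (y : Fin N → X)

theorem siteProd_pos : 0 < M.siteProd D y := Finset.prod_pos fun _ _ => M.site_pos _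

theorem siteProd_le : M.siteProd D y ≤ 1 :=
  Finset.prod_le_one (fun _ _ => (M.site_pos _).le) fun _ _ => M.site_le _

theorem bondProd_pos : 0 < M.bondProd T y := Finset.prod_pos fun _ _ => M.bond_pos _ _

theorem bondProd_le : M.bondProd T y ≤ 1 :=
  Finset.prod_le_one (fun _ _ => (M.bond_pos _ _).le) fun _ _ => M.bond_le _ _

theorem wt_pos : 0 < M.wt D y := mul_pos (M.siteProd_pos D y) (M.bondProd_pos _ y)

theorem wt_le : M.wt D y ≤ 1 :=
  mul_le_one₀ (M.siteProd_le D y) (M.bondProd_pos _ y).le (M.bondProd_le _ y)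

theorem isBdd_siteProd : IsBdd (M.siteProd D) := by
  refine IsBdd.of_le (C := 1) ?_ fun y => ?_
  · exact Finset.measurable_prod _ fun i _ => M.measurable_site.comp (measurable_pi_apply i)
  · rw [abs_of_pos (M.siteProd_pos D y)]; exact M.siteProd_le D y

theorem isBdd_bondProd : IsBdd (M.bondProd T) := by
  refine IsBdd.of_le (C := 1) ?_ fun y => ?_
  · refine Finset.measurable_prod _ fun e _ => ?_
    have h : Measurable fun y : Fin N → X => (y e, y (e + 1)) :=
      (measurable_pi_apply e).prodMk (measurable_pi_apply (e + 1))
    exact M.measurable_bond.comp h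
  · rw [abs_of_pos (M.bondProd_pos T y)]; exact M.bondProd_le T y

theorem isBdd_wt : IsBdd (M.wt D) := (M.isBdd_siteProd D).mul (M.isBdd_bondProd _)

theorem dependsOn_siteProd : DependsOn (M.siteProd D) (D : Set (Fin N)) := fun x y h =>
  Finset.prod_congr rfl fun i hi => by rw [h i hi]

theorem dependsOn_bondProd {u : Set (Fin N)} (h : ∀ e ∈ T, e ∈ u ∧ e + 1 ∈ u) :
    DependsOn (M.bondProd T) u := fun x y hxy =>
  Finset.prod_congr rfl fun e he => by rw [hxy _ (h e he).1, hxy _ (h e he).2]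

theorem dependsOn_wt {u : Set (Fin N)} (hD : (D : Set (Fin N)) ⊆ u)
    (h : ∀ e ∈ touch D, e ∈ u ∧ e + 1 ∈ u) : DependsOn (M.wt D) u := fun x y hxy => by
  unfold wt
  rw [(M.dependsOn_siteProd D).mono hD hxy, M.dependsOn_bondProd _ h hxy]

/-- The mass of the minorising site weight. -/
def minor : ℝ := ∫ x, M.site x * M.floor x ^ 2 ∂M.ν

theorem isBdd_minor : IsBdd fun x => M.site x * M.floor x ^ 2 := by
  refine IsBdd.of_le (C := 1) (M.measurable_site.mul (M.measurable_floor.pow_const 2)) fun x => ?_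
  rw [abs_of_pos (mul_pos (M.site_pos x) (pow_pos (M.floor_pos x) 2))]
  exact mul_le_one₀ (M.site_le x) (pow_pos (M.floor_pos x) 2).le
    (pow_le_one₀ (M.floor_pos x).le (M.floor_le x))

theorem minor_pos : 0 < M.minor :=
  integral_pos_of_pos (M.isBdd_minor.integrable _)
    fun x => mul_pos (M.site_pos x) (pow_pos (M.floor_pos x) 2)

theorem minor_le : M.minor ≤ 1 := by
  have : M.minor ≤ ∫ _ : X, (1 : ℝ) ∂M.ν := by
    refine integral_mono (M.isBdd_minor.integrable _) (integrable_const _) fun x => ?_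
    exact mul_le_one₀ (M.site_le x) (pow_pos (M.floor_pos x) 2).le
      (pow_le_one₀ (M.floor_pos x).le (M.floor_le x))
  simpa using this

/-- Every site of `D` can pay for both of its bonds, so the bonds touching `D` are bounded below by
a product over `D`. -/
theorem prod_floor_le_bondProd : ∏ d ∈ D, M.floor (y d) ^ 2 ≤ M.bondProd (touch D) y := by
  -- the factor `c e` is charged to the left endpoint of the bond `e`, `c (e + 1)` to the right one
  let c : Fin N → ℝ := fun i => if i ∈ D then M.floor (y i) else 1
  have hc0 : ∀ i, 0 < c i := fun i => by
    simp only [c]; split_ifs; exacts [M.floor_pos _, one_pos]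
  have hc1 : ∀ i, c i ≤ 1 := fun i => by
    simp only [c]; split_ifs; exacts [M.floor_le _, le_rfl]
  have hshift : ∏ e, c (e + 1) = ∏ e, c e := Equiv.prod_comp (Equiv.addRight (1 : Fin N)) c
  have hsq : ∏ d ∈ D, M.floor (y d) ^ 2 = ∏ e, (c e * c (e + 1)) := by
    rw [Finset.prod_mul_distrib, hshift, Finset.prod_pow, sq]
    simp [c, Finset.prod_ite_mem]
  have hoff : ∏ e ∈ touch D, (c e * c (e + 1)) = ∏ e, (c e * c (e + 1)) := by
    refine Finset.prod_subset (Finset.subset_univ _) fun e _ he => ?_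
    simp only [touch, Finset.mem_filter, Finset.mem_univ, true_and, not_or] at he
    simp [c, he.1, he.2]
  rw [hsq, ← hoff]
  refine Finset.prod_le_prod (fun e _ => (mul_pos (hc0 _) (hc0 _)).le) fun e he => ?_
  simp only [touch, Finset.mem_filter, Finset.mem_univ, true_and] at he
  rcases he with he | he
  · calc c e * c (e + 1) ≤ c e := mul_le_of_le_one_right (hc0 _).le (hc1 _)
      _ = M.floor (y e) := by simp [c, he]
      _ ≤ _ := M.floor_le_left _ _
  · calc c e * c (e + 1) ≤ c (e + 1) := mul_le_of_le_one_left (hc0 _).le (hc1 _)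
      _ = M.floor (y (e + 1)) := by simp [c, he]
      _ ≤ _ := M.floor_le_right _ _

theorem minor_pow_le_marg_wt : M.minor ^ D.card ≤ marg M.ν D (M.wt D) y := by
  have h1 : M.minor ^ D.card
      = ∫ z, ∏ i, (if i ∈ D then M.site (z i) * M.floor (z i) ^ 2 else 1) ∂M.ref N := by
    rw [integral_fintype_prod_eq_prod (fun i x => if i ∈ D then M.site x * M.floor x ^ 2 else 1)]
    rw [← Finset.prod_const, ← Finset.prod_subset (Finset.subset_univ D)]
    · refine Finset.prod_congr rfl fun i hi => ?_
      simp [hi, minor]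
    · intro i _ hi
      simp [hi]
  have h0 : ∀ z : Fin N → X, ∏ i, (if i ∈ D then M.site (z i) * M.floor (z i) ^ 2 else 1)
      = ∏ i ∈ D, (M.site (z i) * M.floor (z i) ^ 2) := fun z => by
    simp [Finset.prod_ite_mem]
  simp only [h0] at h1
  rw [h1]
  refine integral_mono ?_ (((M.isBdd_wt D).piecewise_left D y).integrable _) fun z => ?_
  · refine (IsBdd.prod D fun i _ => ?_).integrable _
    exact ⟨M.isBdd_minor.1.comp (measurable_pi_apply i), M.isBdd_minor.2.imp fun C hC z => hC _⟩
  · have h2 := M.prod_floor_le_bondProd D (D.piecewise z y)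
    have h3 : ∏ d ∈ D, M.floor (D.piecewise z y d) ^ 2 = ∏ d ∈ D, M.floor (z d) ^ 2 :=
      Finset.prod_congr rfl fun i hi => by simp [hi]
    have h4 : M.siteProd D (D.piecewise z y) = ∏ d ∈ D, M.site (z d) :=
      Finset.prod_congr rfl fun i hi => by simp [hi]
    simp only [wt, Finset.prod_mul_distrib, h4]
    rw [h3] at h2
    exact mul_le_mul_of_nonneg_left h2 (Finset.prod_nonneg fun _ _ => (M.site_pos _).le)

theorem marg_wt_le : marg M.ν D (M.wt D) y ≤ 1 := by
  have := marg_mono (ν := M.ν) (s := D) (M.isBdd_wt D) (isBdd_const 1) (M.wt_le D) y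
  simpa [marg] using this

/-- The unnormalised conditional expectation of `F` given the coordinates outside `A`. -/
def num (A : Finset (Fin N)) (F : (Fin N → X) → ℝ) : (Fin N → X) → ℝ :=
  marg M.ν A fun y => F y * M.wt A y

variable {D T y} {A E : Finset (Fin N)} {F : (Fin N → X) → ℝ}

theorem isBdd_num (hF : IsBdd F) : IsBdd (M.num A F) := (hF.mul (M.isBdd_wt A)).marg _ _

theorem num_one_pos : 0 < M.num A (fun _ => 1) y :=
  marg_pos ((isBdd_const 1).mul (M.isBdd_wt A)) (fun y => by simpa using M.wt_pos A y) A y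

/-- `A` is a set of sites, `E` a layer around it, `D` a layer around `A ∪ E`: every bond touching
`A` stays in `A ∪ E`, the bonds touching `D` avoid `A`, and together these are all the bonds
touching `A ∪ E ∪ D`. -/
structure Layers (A E D : Finset (Fin N)) : Prop where
  disjAE : Disjoint A E
  disjAD : Disjoint A D
  disjED : Disjoint E D
  inner : ∀ e ∈ touch A, e ∈ A ∪ E ∧ e + 1 ∈ A ∪ E
  outer : ∀ e ∈ touch D, e ∉ A ∧ e + 1 ∉ A
  cover : touch (A ∪ E ∪ D) = touch A ∪ touch D

theorem Layers.wt_eq (h : Layers A E D) (y : Fin N → X) :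
    M.wt (A ∪ E ∪ D) y = M.siteProd E y * M.wt A y * M.wt D y := by
  have hd : Disjoint (touch A) (touch D) := Finset.disjoint_left.2 fun e he hD => by
    have := h.outer e hD
    simp only [touch, Finset.mem_filter, Finset.mem_univ, true_and] at he
    tauto
  unfold wt siteProd bondProd
  rw [h.cover, Finset.prod_union hd, Finset.prod_union, Finset.prod_union h.disjAE]
  · ring
  · exact Finset.disjoint_union_left.2 ⟨h.disjAD, h.disjED⟩

/-- Given the outside of `A`, the conditional law of `A` is determined by the layer `E`. -/
theorem Layers.dependsOn_num (h : Layers A E D) (hFA : DependsOn F (A : Set (Fin N))) :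
    DependsOn (M.num A F) (E : Set (Fin N)) := by
  refine (dependsOn_marg ((dependsOn_mul hFA (M.dependsOn_wt A (u := (A : Set (Fin N)) ∪ E)
    Set.subset_union_left fun e he => ?_)).mono
      (Set.union_subset Set.subset_union_left subset_rfl))).mono ?_
  · simpa using h.inner e he
  · intro i hi; simp at hi ⊢; tauto

/-- Integrating out `A`, then `D`, then `E`. -/
theorem Layers.num_eq (h : Layers A E D) (hF : IsBdd F) (hFA : DependsOn F (A : Set (Fin N)))
    (y : Fin N → X) :
    M.num (A ∪ E ∪ D) F y
      = marg M.ν E (fun y => M.siteProd E y * M.num A F y * marg M.ν D (M.wt D) y) y := by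
  have hB : IsBdd fun y => F y * M.wt (A ∪ E ∪ D) y := hF.mul (M.isBdd_wt _)
  have h1 : marg M.ν A (fun y => F y * M.wt (A ∪ E ∪ D) y)
      = fun y => M.siteProd E y * M.num A F y * M.wt D y := by
    funext y
    have hE : DependsOn (M.siteProd E) (E : Set (Fin N)) := M.dependsOn_siteProd E
    have hD : DependsOn (M.wt D) ((A : Set (Fin N))ᶜ) := M.dependsOn_wt D
      (fun i hi hA => Finset.disjoint_left.1 h.disjAD hA hi) fun e he => by
        simpa using h.outer e he
    have := marg_mul_left (ν := M.ν) (s := A) (φ := fun y => F y * M.wt A y) hE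
      (by exact_mod_cast h.disjAE.symm) y
    rw [num, ← this, ← marg_mul_right hD disjoint_compl_left]
    refine congrArg (fun φ => marg M.ν A φ y) (funext fun y => ?_)
    rw [h.wt_eq M]; ring
  have h2 : marg M.ν D (fun y => M.siteProd E y * M.num A F y * M.wt D y)
      = fun y => M.siteProd E y * M.num A F y * marg M.ν D (M.wt D) y := by
    funext y
    refine marg_mul_left (dependsOn_mul (M.dependsOn_siteProd E) (h.dependsOn_num M hFA)) ?_ y
    rw [Set.union_self]
    exact_mod_cast h.disjED
  rw [← h2, ← h1, marg_marg (hB.marg _ _), marg_marg hB, num]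
  congr 1
  ext i; simp; tauto

/-- The conditional expectation of `F` given the outside of `A` lies in `[α, α']`. -/
def CondBetween (F : (Fin N → X) → ℝ) (A : Finset (Fin N)) (α α' : ℝ) : Prop :=
  ∀ y, α * M.num A (fun _ => 1) y ≤ M.num A F y ∧ M.num A F y ≤ α' * M.num A (fun _ => 1) y

/-- Doeblin's argument. The two outer layers separate `A` from the rest by a density bounded
between `minor ^ 2` and `1`, which contracts the range of the conditional expectation. -/
theorem CondBetween.step {α α' : ℝ} (h : Layers A E D) (hcard : D.card ≤ 2) (hF : IsBdd F)
    (hFA : DependsOn F (A : Set (Fin N))) (hA : M.CondBetween F A α α') :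
    ∃ β β', M.CondBetween F (A ∪ E ∪ D) β β' ∧ β' - β = (1 - M.minor ^ 2) * (α' - α) := by
  set c : (Fin N → X) → ℝ := marg M.ν D (M.wt D)
  have hc : IsBdd c := (M.isBdd_wt D).marg _ _
  have hc1 : ∀ y, c y ≤ 1 := M.marg_wt_le D
  have hc0 : ∀ y, M.minor ^ 2 ≤ c y := fun y =>
    (pow_le_pow_of_le_one M.minor_pos.le M.minor_le hcard).trans (M.minor_pow_le_marg_wt D y)
  set κ := M.minor ^ 2
  have hκ : 0 ≤ κ := by positivity
  have hone : IsBdd (fun _ : Fin N → X => (1 : ℝ)) := isBdd_const 1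
  have hone' : DependsOn (fun _ : Fin N → X => (1 : ℝ)) (A : Set (Fin N)) := fun _ _ _ => rfl
  have hs := M.isBdd_siteProd E
  have hp := M.isBdd_num (A := A) hF
  have hq := M.isBdd_num (A := A) hone
  set p : (Fin N → X) → ℝ := marg M.ν E fun y => M.siteProd E y * M.num A F y with hpdef
  set q : (Fin N → X) → ℝ := marg M.ν E fun y => M.siteProd E y * M.num A (fun _ => 1) y with hqdef
  have hconst : ∀ G : (Fin N → X) → ℝ, DependsOn G (A : Set (Fin N)) →
      DependsOn (marg M.ν E fun y => M.siteProd E y * M.num A G y) ∅ := by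
    intro G hG
    refine (dependsOn_marg (dependsOn_mul (M.dependsOn_siteProd E)
      (h.dependsOn_num M hG))).mono ?_
    simp
  have hq0 : ∀ y, 0 < q y := marg_pos (hs.mul hq)
    (fun y => mul_pos (M.siteProd_pos E y) M.num_one_pos) E
  obtain ⟨y₀⟩ := nonempty_of_isProbabilityMeasure (M.ref N)
  have hpc : ∀ y, p y = p y₀ := fun y => (hconst F hFA).empty y y₀
  have hqc : ∀ y, q y = q y₀ := fun y => (hconst _ hone').empty y y₀
  -- the average of the conditional expectation in the uncoupled reference law of `E`
  set m := p y₀ / q y₀ with hm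
  have hpm : ∀ y, p y = m * q y := fun y => by
    rw [hpc, hqc, hm, div_mul_cancel₀ _ (hq0 y₀).ne']
  have hmα : α ≤ m := by
    rw [hm, le_div_iff₀ (hq0 y₀), hpdef, hqdef, ← marg_const_mul]
    refine marg_mono ((hs.mul hq).const_mul α) (hs.mul hp) (fun y => ?_) y₀
    have := mul_le_mul_of_nonneg_left (hA y).1 (M.siteProd_pos E y).le
    linarith
  have hmα' : m ≤ α' := by
    rw [hm, div_le_iff₀ (hq0 y₀), hpdef, hqdef, ← marg_const_mul]
    refine marg_mono (hs.mul hp) ((hs.mul hq).const_mul α') (fun y => ?_) y₀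
    have := mul_le_mul_of_nonneg_left (hA y).2 (M.siteProd_pos E y).le
    linarith
  have hBF := h.num_eq M hF hFA
  have hB1 := h.num_eq M hone hone'
  have hB1q : ∀ y, M.num (A ∪ E ∪ D) (fun _ => 1) y ≤ q y := fun y => by
    rw [hB1]
    refine marg_mono ((hs.mul hq).mul hc) (hs.mul hq) (fun y => ?_) y
    exact mul_le_of_le_one_right (mul_pos (M.siteProd_pos E y) M.num_one_pos).le (hc1 y)
  refine ⟨α + κ * (m - α), α' - κ * (α' - m), fun y => ⟨?_, ?_⟩, by ring⟩
  · have h1 : κ * (p y - α * q y)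
        ≤ M.num (A ∪ E ∪ D) F y - α * M.num (A ∪ E ∪ D) (fun _ => 1) y := by
      rw [hBF, hB1, hpdef, hqdef, ← marg_const_mul,
        ← marg_sub (hs.mul hp) ((hs.mul hq).const_mul α),
        ← marg_const_mul, ← marg_const_mul, ← marg_sub ((hs.mul hp).mul hc)
          (((hs.mul hq).mul hc).const_mul α)]
      refine marg_mono (((hs.mul hp).sub ((hs.mul hq).const_mul α)).const_mul κ)
        (((hs.mul hp).mul hc).sub (((hs.mul hq).mul hc).const_mul α)) (fun y => ?_) y
      have := mul_nonneg (M.siteProd_pos E y).le (sub_nonneg.2 (hA y).1)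
      have := mul_le_mul_of_nonneg_right (hc0 y) this
      linarith
    have h2 : κ * (m - α) * M.num (A ∪ E ∪ D) (fun _ => 1) y ≤ κ * (m - α) * q y :=
      mul_le_mul_of_nonneg_left (hB1q y) (mul_nonneg hκ (sub_nonneg.2 hmα))
    rw [hpm] at h1
    linarith
  · have h1 : κ * (α' * q y - p y)
        ≤ α' * M.num (A ∪ E ∪ D) (fun _ => 1) y - M.num (A ∪ E ∪ D) F y := by
      rw [hBF, hB1, hpdef, hqdef, ← marg_const_mul,
        ← marg_sub ((hs.mul hq).const_mul α') (hs.mul hp),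
        ← marg_const_mul, ← marg_const_mul, ← marg_sub (((hs.mul hq).mul hc).const_mul α')
          ((hs.mul hp).mul hc)]
      refine marg_mono ((((hs.mul hq).const_mul α').sub (hs.mul hp)).const_mul κ)
        ((((hs.mul hq).mul hc).const_mul α').sub ((hs.mul hp).mul hc)) (fun y => ?_) y
      have := mul_nonneg (M.siteProd_pos E y).le (sub_nonneg.2 (hA y).2)
      have := mul_le_mul_of_nonneg_right (hc0 y) this
      linarith
    have h2 : κ * (α' - m) * M.num (A ∪ E ∪ D) (fun _ => 1) y ≤ κ * (α' - m) * q y :=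
      mul_le_mul_of_nonneg_left (hB1q y) (mul_nonneg hκ (sub_nonneg.2 hmα'))
    rw [hpm] at h1
    linarith

end Model

/-! ### The cycle, Gibbs expectations and decay of correlations -/

section CircularDistance

variable {N : ℕ}

/-- The distance on the cycle `Fin N`. -/
def cdist (i j : Fin N) : ℕ :=
  min ((i.val - j.val) + (j.val - i.val)) (N - ((i.val - j.val) + (j.val - i.val)))

theorem cdist_self (i : Fin N) : cdist i i = 0 := by simp [cdist]

theorem cdist_comm (i j : Fin N) : cdist i j = cdist j i := by simp [cdist, add_comm]

theorem cdist_triangle (i j k : Fin N) : cdist i k ≤ cdist i j + cdist j k := by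
  have := i.isLt; have := j.isLt; have := k.isLt
  unfold cdist; omega

theorem cdist_two_mul_le (i j : Fin N) : 2 * cdist i j ≤ N := by
  have := i.isLt; have := j.isLt
  unfold cdist; omega

theorem val_succ [NeZero N] (x : Fin N) :
    (x + 1).val = if x.val + 1 = N then 0 else x.val + 1 := by
  have hx := x.isLt
  rw [Fin.val_add, Fin.val_one']
  rcases Nat.lt_or_ge 1 N with h | h
  · rw [Nat.mod_eq_of_lt h]
    split_ifs with h'
    · rw [h', Nat.mod_self]
    · exact Nat.mod_eq_of_lt (by omega)
  · obtain rfl : N = 1 := by omega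
    simp

theorem cdist_succ [NeZero N] (a x : Fin N) :
    cdist a (x + 1) ≤ cdist a x + 1 ∧ cdist a x ≤ cdist a (x + 1) + 1 := by
  have h := val_succ x
  have := a.isLt; have := x.isLt
  unfold cdist
  rw [h]
  split_ifs <;> omega

theorem cdist_succ_eq [NeZero N] {a x : Fin N} (h : cdist a x = cdist a (x + 1)) :
    N = 2 * cdist a x + 1 := by
  have h' := val_succ x
  have := a.isLt; have := x.isLt
  unfold cdist at h ⊢
  rw [h'] at h
  split_ifs at h <;> omega

theorem card_sphere_le (a : Fin N) (r : ℕ) :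
    (Finset.univ.filter fun x => cdist a x = r).card ≤ 2 := by
  rw [← Finset.card_image_of_injective _ Fin.val_injective]
  refine (Finset.card_le_card (t := {if a.val + r < N then a.val + r else a.val + r - N,
    if r ≤ a.val then a.val - r else a.val + N - r}) fun n hn => ?_).trans Finset.card_le_two
  simp only [Finset.mem_image, Finset.mem_filter, Finset.mem_univ, true_and] at hn
  obtain ⟨x, hx, rfl⟩ := hn
  have := a.isLt; have := x.isLt
  unfold cdist at hx
  simp only [Finset.mem_insert, Finset.mem_singleton]
  split_ifs <;> omega

/-- The ball of radius `k` on the cycle. -/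
def cball (a : Fin N) (k : ℕ) : Finset (Fin N) := Finset.univ.filter fun x => cdist a x ≤ k

theorem mem_cball {a x : Fin N} {k : ℕ} : x ∈ cball a k ↔ cdist a x ≤ k := by simp [cball]

theorem card_cball_le (a : Fin N) (k : ℕ) : (cball a k).card ≤ 2 * (k + 1) := by
  have h : cball a k ⊆ (Finset.range (k + 1)).biUnion
      fun r => Finset.univ.filter fun x => cdist a x = r := fun x hx => by
    simp [mem_cball] at hx ⊢; omega
  refine (Finset.card_le_card h).trans (Finset.card_biUnion_le.trans ?_)
  refine (Finset.sum_le_sum fun r _ => card_sphere_le a r).trans ?_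
  simp [mul_comm]

variable [NeZero N]

theorem cball_add_two (a : Fin N) (R : ℕ) :
    cball a R ∪ (Finset.univ.filter fun x => cdist a x = R + 1)
      ∪ (Finset.univ.filter fun x => cdist a x = R + 2) = cball a (R + 2) := by
  ext x; simp [cball]; omega

theorem layers_cball {a : Fin N} {R : ℕ} (hR : 2 * (R + 2) + 1 < N) :
    Model.Layers (cball a R) (Finset.univ.filter fun x => cdist a x = R + 1)
      (Finset.univ.filter fun x => cdist a x = R + 2) := by
  have hs : ∀ x, cdist a (x + 1) ≤ cdist a x + 1 ∧ cdist a x ≤ cdist a (x + 1) + 1 := cdist_succ a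
  have hn : ∀ x, cdist a x = cdist a (x + 1) → N = 2 * cdist a x + 1 := fun x => cdist_succ_eq
  refine ⟨?_, ?_, ?_, ?_, ?_, ?_⟩
  · rw [Finset.disjoint_left]; intro x; simp [cball]; omega
  · rw [Finset.disjoint_left]; intro x; simp [cball]; omega
  · rw [Finset.disjoint_left]; intro x; simp; omega
  · intro x; have := hs x; simp [cball, touch]; omega
  · intro x; have := hs x; simp [cball, touch]; omega
  · rw [cball_add_two]
    ext x; have := hs x; have := hn x; simp [cball, touch]; omega

end CircularDistance

namespace Model

variable {X : Type*} [MeasurableSpace X] (M : Model X) {N : ℕ} [NeZero N]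
  {F G : (Fin N → X) → ℝ}

theorem CondBetween.iterate {a : Fin N} {l : ℕ} {α α' : ℝ} (hF : IsBdd F)
    (hFA : DependsOn F (cball a l : Set (Fin N))) (h : M.CondBetween F (cball a l) α α') (n : ℕ)
    (hn : 2 * (l + 2 * n) + 1 < N) :
    ∃ β β', M.CondBetween F (cball a (l + 2 * n)) β β' ∧
      β' - β = (1 - M.minor ^ 2) ^ n * (α' - α) := by
  induction n with
  | zero => exact ⟨α, α', h, by simp⟩
  | succ n ih =>
    obtain ⟨β, β', hβ, hd⟩ := ih (by omega)
    have hlay := layers_cball (a := a) (R := l + 2 * n) (by omega)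
    have hmono : (cball a l : Set (Fin N)) ⊆ cball a (l + 2 * n) := fun x hx => by
      simp [cball] at hx ⊢; omega
    obtain ⟨δ, δ', hδ, hd'⟩ := CondBetween.step M hlay (card_sphere_le _ _) hF (hFA.mono hmono) hβ
    rw [cball_add_two] at hδ
    exact ⟨δ, δ', hδ, by rw [hd', hd]; ring⟩

/-- The partition function. -/
def part (N : ℕ) [NeZero N] : ℝ := ∫ y, M.wt Finset.univ y ∂M.ref N

/-- The Gibbs expectation. -/
def avg (φ : (Fin N → X) → ℝ) : ℝ :=
  (∫ y, φ y * M.wt Finset.univ y ∂M.ref N) / M.part N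

theorem part_pos : 0 < M.part N :=
  integral_pos_of_pos ((M.isBdd_wt _).integrable _) (M.wt_pos _)

theorem avg_def (φ : (Fin N → X) → ℝ) :
    M.avg φ = (∫ y, φ y * M.wt Finset.univ y ∂M.ref N) / M.part N := rfl

theorem avg_const (c : ℝ) : M.avg (fun _ : Fin N → X => c) = c := by
  rw [avg_def, integral_const_mul]
  exact mul_div_cancel_right₀ _ M.part_pos.ne'

theorem avg_add (hF : IsBdd F) (hG : IsBdd G) :
    M.avg (fun y => F y + G y) = M.avg F + M.avg G := by
  simp only [avg_def, add_mul]
  rw [integral_add ((hF.mul (M.isBdd_wt _)).integrable _) ((hG.mul (M.isBdd_wt _)).integrable _),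
    add_div]

theorem avg_const_mul (c : ℝ) : M.avg (fun y => c * F y) = c * M.avg F := by
  simp only [avg_def, mul_assoc]
  rw [integral_const_mul, mul_div_assoc]

theorem avg_sub (hF : IsBdd F) (hG : IsBdd G) :
    M.avg (fun y => F y - G y) = M.avg F - M.avg G := by
  simp only [avg_def, sub_mul]
  rw [integral_sub ((hF.mul (M.isBdd_wt _)).integrable _) ((hG.mul (M.isBdd_wt _)).integrable _),
    sub_div]

theorem avg_sum {κ : Type*} (s : Finset κ) {f : κ → (Fin N → X) → ℝ}
    (hf : ∀ i ∈ s, IsBdd (f i)) :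
    M.avg (fun y => ∑ i ∈ s, f i y) = ∑ i ∈ s, M.avg (f i) := by
  simp only [avg_def, Finset.sum_mul]
  rw [integral_finsetSum _ fun i hi => ((hf i hi).mul (M.isBdd_wt _)).integrable _,
    Finset.sum_div]

theorem avg_mono (hF : IsBdd F) (hG : IsBdd G) (h : ∀ y, F y ≤ G y) : M.avg F ≤ M.avg G := by
  rw [avg_def, avg_def]
  refine div_le_div_of_nonneg_right ?_ M.part_pos.le
  refine integral_mono ((hF.mul (M.isBdd_wt _)).integrable _) ((hG.mul (M.isBdd_wt _)).integrable _)
    fun y => ?_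
  exact mul_le_mul_of_nonneg_right (h y) (M.wt_pos _ _).le

/-- The part of the Gibbs weight that does not involve the sites of `A`. -/
def wtCompl (A : Finset (Fin N)) (y : Fin N → X) : ℝ :=
  M.siteProd Aᶜ y * M.bondProd (touch A)ᶜ y

theorem isBdd_wtCompl (A : Finset (Fin N)) : IsBdd (M.wtCompl A) :=
  (M.isBdd_siteProd _).mul (M.isBdd_bondProd _)

theorem wtCompl_pos (A : Finset (Fin N)) (y : Fin N → X) : 0 < M.wtCompl A y :=
  mul_pos (M.siteProd_pos _ _) (M.bondProd_pos _ _)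

theorem wt_mul_wtCompl (A : Finset (Fin N)) (y : Fin N → X) :
    M.wt A y * M.wtCompl A y = M.wt Finset.univ y := by
  have h : touch (Finset.univ : Finset (Fin N)) = Finset.univ := by simp [touch]
  unfold wt wtCompl siteProd bondProd
  rw [h, ← Finset.prod_mul_prod_compl A, ← Finset.prod_mul_prod_compl (touch A)]
  ring

theorem dependsOn_wtCompl (A : Finset (Fin N)) :
    DependsOn (M.wtCompl A) ((A : Set (Fin N))ᶜ) := by
  refine (dependsOn_mul ((M.dependsOn_siteProd _)) (M.dependsOn_bondProd _
    (u := (A : Set (Fin N))ᶜ) fun e he => ?_)).mono ?_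
  · simpa [touch] using he
  · simp

theorem integral_mul_wt (A : Finset (Fin N)) (hF : IsBdd F) (hG : IsBdd G)
    (hGA : DependsOn G ((A : Set (Fin N))ᶜ)) :
    ∫ y, F y * G y * M.wt Finset.univ y ∂M.ref N
      = ∫ y, M.num A F y * (G y * M.wtCompl A y) ∂M.ref N := by
  rw [← integral_marg (s := A) ((hF.mul hG).mul (M.isBdd_wt _))]
  refine integral_congr_ae (Filter.Eventually.of_forall fun y => ?_)
  have h := marg_mul_right (ν := M.ν) (s := A) (φ := fun y => F y * M.wt A y)
    (dependsOn_mul hGA (M.dependsOn_wtCompl A)) (by simp [disjoint_compl_left]) y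
  simp only [num]
  rw [← h]
  refine congrArg (fun φ => marg M.ν A φ y) (funext fun y => ?_)
  rw [← M.wt_mul_wtCompl A]; ring

theorem CondBetween.avg_mul {A : Finset (Fin N)} {α α' : ℝ} (h : M.CondBetween F A α α')
    (hF : IsBdd F) (hG : IsBdd G) (hG0 : ∀ y, 0 ≤ G y)
    (hGA : DependsOn G ((A : Set (Fin N))ᶜ)) :
    α * M.avg G ≤ M.avg (fun y => F y * G y) ∧ M.avg (fun y => F y * G y) ≤ α' * M.avg G := by
  have hone : IsBdd (fun _ : Fin N → X => (1 : ℝ)) := isBdd_const 1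
  have hW := M.isBdd_wtCompl A
  have h1 := M.integral_mul_wt A hone hG hGA
  simp only [one_mul] at h1
  have hw : ∀ y, 0 ≤ G y * M.wtCompl A y := fun y => mul_nonneg (hG0 y) (M.wtCompl_pos A y).le
  have hi1 := (M.isBdd_num (A := A) hone).mul (hG.mul hW)
  have hi2 := (M.isBdd_num (A := A) hF).mul (hG.mul hW)
  rw [avg_def, avg_def, h1, M.integral_mul_wt A hF hG hGA, ← mul_div_assoc, ← mul_div_assoc,
    ← integral_const_mul, ← integral_const_mul]
  refine ⟨div_le_div_of_nonneg_right ?_ M.part_pos.le,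
    div_le_div_of_nonneg_right ?_ M.part_pos.le⟩
  · refine integral_mono ((hi1.const_mul α).integrable _) (hi2.integrable _) fun y => ?_
    have := mul_le_mul_of_nonneg_right (h y).1 (hw y)
    simp only; linarith
  · refine integral_mono (hi2.integrable _) ((hi1.const_mul α').integrable _) fun y => ?_
    have := mul_le_mul_of_nonneg_right (h y).2 (hw y)
    simp only; linarith

/-- Exponential decay of correlations on the cycle. -/
theorem abs_avg_mul_sub_le {a : Fin N} {l n : ℕ} (hF : Measurable F) (hG : Measurable G)
    (hF1 : ∀ y, |F y| ≤ 1) (hG1 : ∀ y, |G y| ≤ 1)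
    (hFA : DependsOn F (cball a l : Set (Fin N)))
    (hGA : DependsOn G ((cball a (l + 2 * n) : Set (Fin N))ᶜ)) :
    |M.avg (fun y => F y * G y) - M.avg F * M.avg G| ≤ 4 * (1 - M.minor ^ 2) ^ n := by
  have hFb := IsBdd.of_le hF hF1
  have hGb := IsBdd.of_le hG hG1
  have hm0 := M.minor_pos
  have hm1 := M.minor_le
  have hκ : 0 ≤ 1 - M.minor ^ 2 := by nlinarith
  rcases Nat.lt_or_ge (2 * (l + 2 * n) + 1) N with hN | hN
  · have h0 : M.CondBetween F (cball a l) (-1) 1 := fun y => by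
      have hone := ((isBdd_const (1 : ℝ)).mul (M.isBdd_wt (cball a l)))
      unfold num
      rw [← marg_const_mul, ← marg_const_mul]
      refine ⟨marg_mono (hone.const_mul _) (hFb.mul (M.isBdd_wt _)) (fun y => ?_) y,
        marg_mono (hFb.mul (M.isBdd_wt _)) (hone.const_mul _) (fun y => ?_) y⟩
      · have := mul_le_mul_of_nonneg_right (abs_le.1 (hF1 y)).1 (M.wt_pos (cball a l) y).le
        linarith
      · have := mul_le_mul_of_nonneg_right (abs_le.1 (hF1 y)).2 (M.wt_pos (cball a l) y).le
        linarith
    obtain ⟨β, β', hβ, hd⟩ := h0.iterate M hFb hFA n hN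
    -- shift `G` to make it nonnegative; this leaves the covariance unchanged
    have hG' : IsBdd fun y => G y + 1 := hGb.add (isBdd_const 1)
    obtain ⟨h1, h2⟩ := hβ.avg_mul M hFb hG' (fun y => by linarith [(abs_le.1 (hG1 y)).1])
      (fun x y hxy => by simp only [hGA hxy])
    obtain ⟨h3, h4⟩ := hβ.avg_mul M hFb (isBdd_const 1) (fun y => zero_le_one)
      (fun x y _ => rfl)
    have h5 : M.avg (fun y => F y * (G y + 1)) = M.avg (fun y => F y * G y) + M.avg F := by
      rw [← M.avg_add (hFb.mul hGb) hFb]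
      congr 1; funext y; ring
    have h6 : M.avg (fun y => G y + 1) = M.avg G + 1 := by
      rw [M.avg_add hGb (isBdd_const 1), M.avg_const]
    have h7 : M.avg G ≤ 1 := by
      rw [← M.avg_const (N := N) 1]
      exact M.avg_mono hGb (isBdd_const 1) fun y => (abs_le.1 (hG1 y)).2
    have h8 : -1 ≤ M.avg G := by
      rw [← M.avg_const (N := N) (-1)]
      exact M.avg_mono (isBdd_const _) hGb fun y => (abs_le.1 (hG1 y)).1
    rw [h5, h6] at h1 h2
    simp only [mul_one, M.avg_const] at h3 h4
    have h9 : (β' - β) * (M.avg G + 1) ≤ (β' - β) * 2 :=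
      mul_le_mul_of_nonneg_left (by linarith) (by linarith)
    have h10 : (M.avg F - β) * (M.avg G + 1) ≤ (β' - β) * (M.avg G + 1) :=
      mul_le_mul_of_nonneg_right (by linarith) (by linarith)
    have h11 : (β' - M.avg F) * (M.avg G + 1) ≤ (β' - β) * (M.avg G + 1) :=
      mul_le_mul_of_nonneg_right (by linarith) (by linarith)
    rw [abs_le]
    constructor <;> nlinarith
  · -- the outer region is empty
    have hc : DependsOn G ∅ := hGA.mono fun x hx => by
      have := cdist_two_mul_le a x
      simp [cball] at hx ⊢; omega
    obtain ⟨y₀⟩ := nonempty_of_isProbabilityMeasure (M.ref N)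
    have hG' : G = fun _ => G y₀ := funext fun y => hc.empty y y₀
    have h : M.avg (fun y => F y * G y) = M.avg F * G y₀ := by
      rw [hG']
      simp only [mul_comm _ (G y₀)]
      exact M.avg_const_mul _
    have h' : M.avg G = G y₀ := by
      rw [hG']
      exact M.avg_const _
    rw [h, h', sub_self, abs_zero]
    positivity

end Model

/-! ### Linear growth of the variance -/

namespace Model

variable {X : Type*} [MeasurableSpace X] (M : Model X) {N : ℕ} [NeZero N]
  {v : X → ℝ} {φ : (Fin N → X) → ℝ}

/-- The mean of `v` under the minorising law. -/
def minorMean (v : X → ℝ) : ℝ := (∫ x, M.site x * M.floor x ^ 2 * v x ∂M.ν) / M.minor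

/-- The unnormalised variance of `v` under the minorising law. -/
def minorVar (v : X → ℝ) : ℝ :=
  ∫ x, M.site x * M.floor x ^ 2 * (v x - M.minorMean v) ^ 2 ∂M.ν

/-- A local test function: dividing by the bonds at `d` turns the conditional law of the `d`-th
spin into the minorising law, under which `v` is centred. -/
def score (v : X → ℝ) (d : Fin N) (y : Fin N → X) : ℝ :=
  M.floor (y d) ^ 2 * (v (y d) - M.minorMean v) / M.bondProd (touch {d}) y

theorem minorMean_mem (hv : Measurable v) (h0 : ∀ x, 0 ≤ v x) (h1 : ∀ x, v x ≤ 1) :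
    0 ≤ M.minorMean v ∧ M.minorMean v ≤ 1 := by
  have hpos : ∀ x, 0 ≤ M.site x * M.floor x ^ 2 := fun x =>
    (mul_pos (M.site_pos x) (pow_pos (M.floor_pos x) 2)).le
  refine ⟨div_nonneg (integral_nonneg fun x => mul_nonneg (hpos x) (h0 x)) M.minor_pos.le, ?_⟩
  refine div_le_one_of_le₀ ?_ M.minor_pos.le
  refine integral_mono ((M.isBdd_minor.mul (isBdd_of_unit hv h0 h1)).integrable _)
    (M.isBdd_minor.integrable _) fun x => ?_
  exact mul_le_of_le_one_right (hpos x) (h1 x)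

theorem abs_score_le (hv : Measurable v) (h0 : ∀ x, 0 ≤ v x) (h1 : ∀ x, v x ≤ 1) (d : Fin N)
    (y : Fin N → X) : |M.score v d y| ≤ 1 := by
  obtain ⟨hm0, hm1⟩ := M.minorMean_mem hv h0 h1
  have hb := M.bondProd_pos (touch {d}) y
  have hf := M.prod_floor_le_bondProd {d} y
  rw [Finset.prod_singleton] at hf
  rw [score, abs_div, abs_of_pos hb, abs_mul, abs_of_pos (pow_pos (M.floor_pos _) 2)]
  refine div_le_one_of_le₀ ?_ hb.le
  refine (mul_le_of_le_one_right (pow_pos (M.floor_pos _) 2).le ?_).trans hf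
  rw [abs_le]
  constructor <;> linarith [h0 (y d), h1 (y d)]

theorem isBdd_score (hv : Measurable v) (h0 : ∀ x, 0 ≤ v x) (h1 : ∀ x, v x ≤ 1) (d : Fin N) :
    IsBdd (M.score v d) := by
  refine IsBdd.of_le ?_ (M.abs_score_le hv h0 h1 d)
  have h := measurable_pi_apply (X := fun _ : Fin N => X) d
  exact (((M.measurable_floor.comp h).pow_const 2).mul ((hv.comp h).sub_const _)).div
    (M.isBdd_bondProd _).1

/-- The score at `d` only sees `d` and its two neighbours. -/
theorem dependsOn_score (d : Fin N) :
    DependsOn (M.score v d) {j | d = j ∨ d + 1 = j ∨ j + 1 = d} := fun x y hxy => by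
  have h1 : x d = y d := hxy d (Or.inl rfl)
  have h2 : M.bondProd (touch {d}) x = M.bondProd (touch {d}) y := by
    refine M.dependsOn_bondProd _ (fun e he => ?_) hxy
    simp only [touch, Finset.mem_filter, Finset.mem_univ, true_and, Finset.mem_singleton] at he
    rcases he with rfl | he
    · exact ⟨Or.inl rfl, Or.inr (Or.inl rfl)⟩
    · exact ⟨Or.inr (Or.inr he), Or.inl he.symm⟩
  simp only [score, h1, h2]

theorem num_score (d : Fin N) (u : X → ℝ) (hu : Measurable u) (hv : Measurable v)
    (y : Fin N → X) :
    M.num {d} (fun y => M.score v d y * u (y d)) y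
      = ∫ x, M.site x * M.floor x ^ 2 * (v x - M.minorMean v) * u x ∂M.ν := by
  have hmp : MeasurePreserving (fun z : Fin N → X => z d) (M.ref N) M.ν :=
    measurePreserving_eval (fun _ => M.ν) d
  have hm : Measurable fun x => M.site x * M.floor x ^ 2 * (v x - M.minorMean v) * u x :=
    ((M.measurable_site.mul (M.measurable_floor.pow_const 2)).mul (hv.sub_const _)).mul hu
  conv_rhs => rw [← hmp.map_eq]
  rw [integral_map hmp.measurable.aemeasurable hm.aestronglyMeasurable]
  refine integral_congr_ae (Filter.Eventually.of_forall fun z => ?_)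
  have hb := (M.bondProd_pos (touch {d}) (Finset.piecewise {d} z y)).ne'
  simp only [score, wt, siteProd, Finset.prod_singleton]
  rw [Finset.piecewise_eq_of_mem _ _ _ (Finset.mem_singleton_self d)]
  field_simp

theorem integral_minor_centred (hv : Measurable v) (h0 : ∀ x, 0 ≤ v x) (h1 : ∀ x, v x ≤ 1) :
    ∫ x, M.site x * M.floor x ^ 2 * (v x - M.minorMean v) ∂M.ν = 0 := by
  simp only [mul_sub]
  rw [integral_sub ((M.isBdd_minor.mul (isBdd_of_unit hv h0 h1)).integrable _)
    ((M.isBdd_minor.mul (isBdd_const _)).integrable _), integral_mul_const, minorMean]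
  change _ - M.minor * _ = 0
  rw [mul_div_cancel₀ _ M.minor_pos.ne', sub_self]

theorem avg_score_mul_eq_zero (hv : Measurable v) (h0 : ∀ x, 0 ≤ v x) (h1 : ∀ x, v x ≤ 1)
    (d : Fin N) (hφ : IsBdd φ) (hd : DependsOn φ ({d} : Set (Fin N))ᶜ) :
    M.avg (fun y => M.score v d y * φ y) = 0 := by
  rw [avg_def, M.integral_mul_wt {d} (M.isBdd_score hv h0 h1 d) hφ (by simpa using hd)]
  have h : ∀ y, M.num {d} (M.score v d) y = 0 := fun y => by
    have := M.num_score d (fun _ => 1) measurable_const hv y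
    simp only [mul_one] at this
    rw [M.integral_minor_centred hv h0 h1] at this
    exact this
  simp [h]

theorem minorVar_le_avg_score_mul (hv : Measurable v) (h0 : ∀ x, 0 ≤ v x) (h1 : ∀ x, v x ≤ 1)
    (d : Fin N) : M.minorVar v ≤ M.avg (fun y => M.score v d y * v (y d)) := by
  have hvb := isBdd_of_unit hv h0 h1
  have hvd : IsBdd fun y : Fin N → X => v (y d) :=
    ⟨hvb.1.comp (measurable_pi_apply d), hvb.2.imp fun C hC z => hC _⟩
  have hnum : ∀ y, M.num {d} (fun y => M.score v d y * v (y d)) y = M.minorVar v := fun y => by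
    rw [M.num_score d v hv hv y, minorVar]
    have hc := M.isBdd_minor.mul (hvb.sub (isBdd_const (M.minorMean v)))
    have h2 := M.integral_minor_centred hv h0 h1
    have h3 : ∫ x, M.site x * M.floor x ^ 2 * (v x - M.minorMean v) * M.minorMean v ∂M.ν = 0 := by
      rw [integral_mul_const, h2, zero_mul]
    rw [← sub_zero (∫ x, M.site x * M.floor x ^ 2 * (v x - M.minorMean v) * v x ∂M.ν), ← h3,
      ← integral_sub ((hc.mul hvb).integrable _) ((hc.mul (isBdd_const _)).integrable _)]
    congr 1; funext x; ring
  have h2 : (∫ y, M.score v d y * v (y d) * M.wt Finset.univ y ∂M.ref N)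
      = M.minorVar v * ∫ y, M.wtCompl {d} y ∂M.ref N := by
    have := M.integral_mul_wt {d} ((M.isBdd_score hv h0 h1 d).mul hvd)
      (isBdd_const 1) (fun _ _ _ => rfl)
    simp only [mul_one, one_mul, hnum] at this
    rw [this, integral_const_mul]
  have hV : 0 ≤ M.minorVar v := integral_nonneg fun x =>
    mul_nonneg (mul_pos (M.site_pos x) (pow_pos (M.floor_pos x) 2)).le (sq_nonneg _)
  rw [avg_def, h2, le_div_iff₀ M.part_pos]
  refine mul_le_mul_of_nonneg_left ?_ hV
  refine integral_mono ((M.isBdd_wt _).integrable _) ((M.isBdd_wtCompl _).integrable _) fun y => ?_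
  simp only [← M.wt_mul_wtCompl {d} y]
  exact mul_le_of_le_one_left (M.wtCompl_pos _ y).le (M.wt_le _ y)

theorem card_touching_le (d : Fin N) :
    (Finset.univ.filter fun d' : Fin N => d' = d ∨ d' + 1 = d ∨ d + 1 = d').card ≤ 3 := by
  refine (Finset.card_le_card (t := {d, d - 1, d + 1}) fun d' hd' => ?_).trans Finset.card_le_three
  simp only [Finset.mem_filter, Finset.mem_univ, true_and] at hd'
  simp only [Finset.mem_insert, Finset.mem_singleton]
  rcases hd' with h | h | h
  · exact Or.inl h
  · exact Or.inr (Or.inl (eq_sub_of_add_eq h))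
  · exact Or.inr (Or.inr h.symm)

/-- The variance of the sum of `v` over the sites grows at least linearly. This is the
Cauchy–Schwarz inequality against the sum of the scores: scores at non-neighbouring sites are
uncorrelated, and the score at `d` is uncorrelated with all the spins except the `d`-th one. -/
theorem le_avg_sq (hv : Measurable v) (h0 : ∀ x, 0 ≤ v x) (h1 : ∀ x, v x ≤ 1) (m : ℝ) :
    N * M.minorVar v ^ 2 / 3 ≤ M.avg (fun y : Fin N → X => (∑ i, v (y i) - m) ^ 2) := by
  have hvb := isBdd_of_unit hv h0 h1
  have hvi : ∀ i, IsBdd fun y : Fin N → X => v (y i) := fun i =>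
    ⟨hvb.1.comp (measurable_pi_apply i), hvb.2.imp fun C hC z => hC _⟩
  have hs : ∀ d : Fin N, IsBdd (M.score v d) := M.isBdd_score hv h0 h1
  set S : (Fin N → X) → ℝ := fun y => ∑ i, v (y i) - m with hS
  set T : (Fin N → X) → ℝ := fun y => ∑ d, M.score v d y with hT
  have hSb : IsBdd S := (IsBdd.sum _ fun i _ => hvi i).sub (isBdd_const m)
  have hTb : IsBdd T := IsBdd.sum _ fun i _ => hs i
  have hST : N * M.minorVar v ≤ M.avg fun y => S y * T y := by
    have h2 : (fun y => S y * T y) = fun y => ∑ d, M.score v d y * S y := by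
      funext y; simp only [hT, mul_comm (S y), Finset.sum_mul]
    rw [h2, M.avg_sum _ fun d _ => (hs d).mul hSb]
    have h3 : ∀ d : Fin N, M.minorVar v ≤ M.avg fun y => M.score v d y * S y := fun d => by
      set R : (Fin N → X) → ℝ := fun y => ∑ i ∈ Finset.univ.erase d, v (y i) - m with hR
      have hRb : IsBdd R := (IsBdd.sum _ fun i _ => hvi i).sub (isBdd_const m)
      have h4 : (fun y => M.score v d y * S y)
          = fun y => M.score v d y * v (y d) + M.score v d y * R y := by
        funext y
        simp only [hS, hR, ← Finset.add_sum_erase _ (fun i => v (y i)) (Finset.mem_univ d)]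
        ring
      rw [h4, M.avg_add ((hs d).mul (hvi d)) ((hs d).mul hRb),
        M.avg_score_mul_eq_zero hv h0 h1 d hRb, add_zero]
      · exact M.minorVar_le_avg_score_mul hv h0 h1 d
      · intro x y hxy
        simp only [hR]
        refine congrArg (· - m) (Finset.sum_congr rfl fun i hi => ?_)
        rw [hxy i (by simpa using hi)]
    calc (N : ℝ) * M.minorVar v = ∑ _d : Fin N, M.minorVar v := by simp
      _ ≤ _ := Finset.sum_le_sum fun d _ => h3 d
  have hTT : M.avg (fun y => T y * T y) ≤ 3 * N := by
    have h2 : (fun y => T y * T y) = fun y => ∑ d, ∑ d', M.score v d y * M.score v d' y := by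
      funext y; simp only [hT, Finset.sum_mul_sum]
    rw [h2, M.avg_sum _ fun d _ => IsBdd.sum _ fun d' _ => (hs d).mul (hs d')]
    have h3 : ∀ d : Fin N, M.avg (fun y => ∑ d', M.score v d y * M.score v d' y) ≤ 3 := fun d => by
      rw [M.avg_sum _ fun d' _ => (hs d).mul (hs d')]
      have h4 : ∀ d', M.avg (fun y => M.score v d y * M.score v d' y)
          ≤ if d' = d ∨ d' + 1 = d ∨ d + 1 = d' then 1 else 0 := fun d' => by
        split_ifs with h
        · rw [← M.avg_const (N := N) 1]
          refine M.avg_mono ((hs d).mul (hs d')) (isBdd_const 1) fun y => ?_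
          refine (le_abs_self _).trans ?_
          rw [abs_mul]
          exact mul_le_one₀ (M.abs_score_le hv h0 h1 d y) (abs_nonneg _)
            (M.abs_score_le hv h0 h1 d' y)
        · rw [M.avg_score_mul_eq_zero hv h0 h1 d (hs d')]
          refine (M.dependsOn_score d').mono fun j hj => ?_
          rintro rfl
          exact h hj
      refine (Finset.sum_le_sum fun d' _ => h4 d').trans ?_
      rw [Finset.sum_boole]
      exact_mod_cast card_touching_le d
    calc _ ≤ ∑ _d : Fin N, (3 : ℝ) := Finset.sum_le_sum fun d _ => h3 d
      _ = 3 * N := by simp [mul_comm]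
  set V := M.minorVar v
  have hV : 0 ≤ V := integral_nonneg fun x =>
    mul_nonneg (mul_pos (M.site_pos x) (pow_pos (M.floor_pos x) 2)).le (sq_nonneg _)
  -- expand the square of `S - (V / 3) T`
  have hsq : 2 * (V / 3) * M.avg (fun y => S y * T y) - (V / 3) ^ 2 * M.avg (fun y => T y * T y)
      ≤ M.avg fun y => S y ^ 2 := by
    rw [← avg_const_mul, ← avg_const_mul,
      ← avg_sub _ ((hSb.mul hTb).const_mul _) ((hTb.mul hTb).const_mul _)]
    refine M.avg_mono (((hSb.mul hTb).const_mul _).sub ((hTb.mul hTb).const_mul _))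
      (by simpa only [sq] using hSb.mul hSb) fun y => ?_
    nlinarith [sq_nonneg (S y - V / 3 * T y)]
  have h5 := mul_le_mul_of_nonneg_left hST (show 0 ≤ 2 * (V / 3) by positivity)
  have h6 := mul_le_mul_of_nonneg_left hTT (sq_nonneg (V / 3))
  refine le_trans (le_of_eq ?_) (le_trans (sub_le_sub h5 h6) hsq)
  ring

end Model

/-! ### Stein's equation and the Kolmogorov distance -/

section Stein

open Filter Topology

theorem hasDerivAt_exp_neg_sq (x : ℝ) :
    HasDerivAt (fun t : ℝ => Real.exp (-t ^ 2 / 2)) (-x * Real.exp (-x ^ 2 / 2)) x := by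
  have h : HasDerivAt (fun t : ℝ => -t ^ 2 / 2) (-x) x := by
    refine ((hasDerivAt_pow 2 x).neg.div_const 2).congr_deriv ?_
    simp; ring
  exact h.exp.congr_deriv (by ring)

/-- `2 / (1 + t) * exp (-t ^ 2 / 2)` is a barrier: its derivative is at most `-exp (-t ^ 2 / 2)`
on `[0, ∞)`, so it dominates the Gaussian tail without any integration. -/
theorem le_of_hasDerivAt_gaussian {u r : ℝ → ℝ} {R : ℝ} (hr : ∀ x, |r x| ≤ R)
    (hu : ∀ x, HasDerivAt u (r x * Real.exp (-x ^ 2 / 2)) x) (hlim : Tendsto u atTop (𝓝 0))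
    {x : ℝ} (hx : 0 ≤ x) : u x ≤ 2 * R / (1 + x) * Real.exp (-x ^ 2 / 2) := by
  have hR : 0 ≤ R := (abs_nonneg _).trans (hr 0)
  have hw : ∀ t, 0 ≤ t → HasDerivAt (fun t => u t - 2 * R / (1 + t) * Real.exp (-t ^ 2 / 2))
      (r t * Real.exp (-t ^ 2 / 2) - ((-(2 * R) / (1 + t) ^ 2) * Real.exp (-t ^ 2 / 2)
        + 2 * R / (1 + t) * (-t * Real.exp (-t ^ 2 / 2)))) t := by
    intro t ht
    have h1 : HasDerivAt (fun t : ℝ => 2 * R / (1 + t)) (-(2 * R) / (1 + t) ^ 2) t := by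
      have h2 : HasDerivAt (fun t : ℝ => 1 + t) 1 t := (hasDerivAt_id t).const_add 1
      exact ((hasDerivAt_const t (2 * R)).div h2 (by positivity)).congr_deriv (by ring)
    exact (hu t).sub (h1.mul (hasDerivAt_exp_neg_sq t))
  have hmono : MonotoneOn (fun t => u t - 2 * R / (1 + t) * Real.exp (-t ^ 2 / 2)) (Set.Ici x) := by
    refine monotoneOn_of_deriv_nonneg (convex_Ici x)
      (fun t ht => (hw t (hx.trans ht)).continuousAt.continuousWithinAt)
      (fun t ht => ?_) fun t ht => ?_
    · rw [interior_Ici] at ht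
      exact (hw t (hx.trans ht.le)).differentiableAt.differentiableWithinAt
    · rw [interior_Ici] at ht
      have ht0 : 0 ≤ t := hx.trans ht.le
      rw [(hw t ht0).deriv]
      have h1 : R ≤ 2 * R / (1 + t) ^ 2 + 2 * R / (1 + t) * t := by
        have : 2 * R / (1 + t) ^ 2 + 2 * R / (1 + t) * t - R
            = R * (1 + t ^ 2) / (1 + t) ^ 2 := by
          field_simp; ring
        have h0 : 0 ≤ R * (1 + t ^ 2) / (1 + t) ^ 2 := by positivity
        linarith
      have h2 := (abs_le.1 (hr t)).1
      have h3 : 0 ≤ (r t + (2 * R / (1 + t) ^ 2 + 2 * R / (1 + t) * t)) * Real.exp (-t ^ 2 / 2) :=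
        mul_nonneg (by linarith) (Real.exp_pos _).le
      convert h3 using 1
      ring
  have hE : Tendsto (fun t : ℝ => 2 * R / (1 + t) * Real.exp (-t ^ 2 / 2)) atTop (𝓝 0) := by
    have h1 : Tendsto (fun t : ℝ => 2 * R / (1 + t)) atTop (𝓝 0) :=
      tendsto_const_nhds.div_atTop (tendsto_atTop_add_const_left _ 1 tendsto_id)
    refine squeeze_zero' ?_ ?_ h1
    · filter_upwards [eventually_ge_atTop 0] with t ht
      positivity
    · filter_upwards [eventually_ge_atTop 0] with t ht
      refine mul_le_of_le_one_right (by positivity) (Real.exp_le_one_iff.2 ?_)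
      nlinarith [sq_nonneg t]
  have hlim' := hlim.sub hE
  rw [sub_zero] at hlim'
  have := ge_of_tendsto hlim' ((eventually_ge_atTop x).mono fun t ht =>
    hmono Set.self_mem_Ici ht ht)
  linarith

theorem abs_le_of_hasDerivAt_gaussian {u r : ℝ → ℝ} {R : ℝ} (hr : ∀ x, |r x| ≤ R)
    (hu : ∀ x, HasDerivAt u (r x * Real.exp (-x ^ 2 / 2)) x) (htop : Tendsto u atTop (𝓝 0))
    (hbot : Tendsto u atBot (𝓝 0)) (x : ℝ) :
    |u x| ≤ 2 * R / (1 + |x|) * Real.exp (-x ^ 2 / 2) := by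
  have key : ∀ (u r : ℝ → ℝ), (∀ x, |r x| ≤ R) →
      (∀ x, HasDerivAt u (r x * Real.exp (-x ^ 2 / 2)) x) → Tendsto u atTop (𝓝 0) →
      ∀ x, 0 ≤ x → |u x| ≤ 2 * R / (1 + x) * Real.exp (-x ^ 2 / 2) := by
    intro u r hr hu htop x hx
    refine abs_le'.2 ⟨le_of_hasDerivAt_gaussian hr hu htop hx, ?_⟩
    refine le_of_hasDerivAt_gaussian (u := fun x => -u x) (r := fun x => -r x)
      (fun x => by rw [abs_neg]; exact hr x) (fun x => ?_) (by simpa using htop.neg) hx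
    exact (hu x).neg.congr_deriv (by ring)
  rcases le_total 0 x with hx | hx
  · rw [abs_of_nonneg hx]
    exact key u r hr hu htop x hx
  · have := key (fun t => u (-t)) (fun t => -r (-t)) (fun t => by rw [abs_neg]; exact hr _)
      (fun t => ?_) (hbot.comp tendsto_neg_atTop_atBot) (-x) (by linarith)
    · rw [abs_of_nonpos hx]
      simpa using this
    · exact ((hu (-t)).comp t (hasDerivAt_neg t)).congr_deriv (by simp)

/-- A bounded solution of `f' - x f = r` decays like `1 / |x|`. -/
theorem abs_le_of_stein {f r : ℝ → ℝ} {R B : ℝ} (hr : ∀ x, |r x| ≤ R) (hB : ∀ x, |f x| ≤ B)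
    (hf : ∀ x, HasDerivAt f (x * f x + r x) x) (x : ℝ) : |f x| ≤ 2 * R / (1 + |x|) := by
  have hexp : ∀ l : Filter ℝ, Tendsto (fun x : ℝ => x ^ 2) l atTop →
      Tendsto (fun x => f x * Real.exp (-x ^ 2 / 2)) l (𝓝 0) := by
    intro l hl
    have h1 : Tendsto (fun x : ℝ => Real.exp (-x ^ 2 / 2)) l (𝓝 0) := by
      refine Real.tendsto_exp_atBot.comp ?_
      have := (hl.atTop_div_const (show (0 : ℝ) < 2 by norm_num))
      refine (tendsto_neg_atTop_atBot.comp this).congr fun x => ?_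
      simp [neg_div]
    refine squeeze_zero_norm (a := fun x => B * Real.exp (-x ^ 2 / 2)) (fun x => ?_) ?_
    · rw [Real.norm_eq_abs, abs_mul, Real.abs_exp]
      exact mul_le_mul_of_nonneg_right (hB x) (Real.exp_pos _).le
    · simpa using h1.const_mul B
  have h := abs_le_of_hasDerivAt_gaussian (u := fun x => f x * Real.exp (-x ^ 2 / 2)) hr
    (fun x => ?_) (hexp _ (tendsto_pow_atTop two_ne_zero)) (hexp _ ?_) x
  · rw [abs_mul, Real.abs_exp] at h
    exact le_of_mul_le_mul_right h (Real.exp_pos _)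
  · exact ((hf x).mul (hasDerivAt_exp_neg_sq x)).congr_deriv (by ring)
  · exact (tendsto_pow_atTop (α := ℝ) two_ne_zero).comp tendsto_abs_atBot_atTop |>.congr
      fun x => by simp

/-- Stein's equation `f' - x f = h - E h(Z)` has a solution `f` that is bounded together with `f'`,
and whose derivative has a Lipschitz constant of the order of that of `h`. -/
theorem exists_stein_solution {h h' : ℝ → ℝ} {L : ℝ} (hd : ∀ x, HasDerivAt h (h' x) x)
    (h0 : ∀ x, 0 ≤ h x) (h1 : ∀ x, h x ≤ 1) (hL : ∀ x, |h' x| ≤ L) :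
    ∃ f f' : ℝ → ℝ, (∀ x, HasDerivAt f (f' x) x) ∧ (∀ x, |f x| ≤ 2) ∧ (∀ x, |f' x| ≤ 3) ∧
      (∀ x y, |f' x - f' y| ≤ (6 + 3 * L) * |x - y|) ∧
      ∀ x, f' x - x * f x = h x - ∫ t, h t ∂(gaussianReal 0 1) := by
  have hcont : Continuous h := continuous_iff_continuousAt.2 fun x => (hd x).continuousAt
  have hint : Integrable h (gaussianReal 0 1) :=
    Integrable.of_bound hcont.aestronglyMeasurable 1 (Eventually.of_forall fun x => by
      rw [Real.norm_eq_abs, abs_of_nonneg (h0 x)]; exact h1 x)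
  set m := ∫ t, h t ∂(gaussianReal 0 1) with hm
  have hm0 : 0 ≤ m := integral_nonneg h0
  have hm1 : m ≤ 1 := by
    have := integral_mono hint (integrable_const (1 : ℝ)) h1
    simpa using this
  set r : ℝ → ℝ := fun x => h x - m with hr
  have hr1 : ∀ x, |r x| ≤ 1 := fun x => by
    rw [abs_le]; constructor <;> simp only [hr] <;> linarith [h0 x, h1 x]
  set g : ℝ → ℝ := fun x => r x * Real.exp (-x ^ 2 / 2) with hg
  have hgc : Continuous g := by
    have : Continuous r := hcont.sub continuous_const
    fun_prop
  have hexpi : Integrable fun x : ℝ => Real.exp (-x ^ 2 / 2) := by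
    have := integrable_exp_neg_mul_sq (show (0 : ℝ) < 1 / 2 by norm_num)
    refine this.congr (Eventually.of_forall fun x => ?_)
    simp only; congr 1; ring
  have hgi : Integrable g := by
    refine hexpi.mono' hgc.aestronglyMeasurable (Eventually.of_forall fun x => ?_)
    rw [Real.norm_eq_abs, abs_mul, Real.abs_exp]
    exact mul_le_of_le_one_left (Real.exp_pos _).le (hr1 x)
  have hg0 : ∫ x, g x = 0 := by
    have h2 : ∫ x, r x ∂(gaussianReal 0 1) = 0 := by
      simp only [hr]
      rw [integral_sub hint (integrable_const _)]
      simp [hm]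
    rw [integral_gaussianReal_eq_integral_smul one_ne_zero] at h2
    have h3 : (fun x => gaussianPDFReal 0 1 x • r x) = fun x => (√(2 * Real.pi))⁻¹ * g x := by
      funext x
      simp only [gaussianPDFReal, hg, smul_eq_mul, NNReal.coe_one, mul_one, sub_zero]
      ring
    rw [h3, integral_const_mul] at h2
    exact (mul_eq_zero.1 h2).resolve_left (by positivity)
  set u : ℝ → ℝ := fun x => ∫ t in Set.Iic x, g t with hu
  have hud : ∀ x, HasDerivAt u (g x) x := by
    intro x
    have h2 : u = fun x => u 0 + ∫ t in (0 : ℝ)..x, g t := by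
      funext x
      rw [← intervalIntegral.integral_Iic_sub_Iic hgi.integrableOn hgi.integrableOn]
      simp [hu]
    rw [h2]
    exact (hgc.integral_hasStrictDerivAt 0 x).hasDerivAt.const_add _
  have hutop : Tendsto u atTop (𝓝 0) := by
    have := (aecover_Iic (μ := volume)
      (tendsto_id (x := (atTop : Filter ℝ)))).integral_tendsto_of_countably_generated hgi
    rwa [hg0] at this
  have hubot : Tendsto u atBot (𝓝 0) := tendsto_integral_Iic_zero tendsto_id
  have hub := abs_le_of_hasDerivAt_gaussian hr1 hud hutop hubot
  set f : ℝ → ℝ := fun x => u x * Real.exp (x ^ 2 / 2) with hf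
  have hee : ∀ x : ℝ, Real.exp (-x ^ 2 / 2) * Real.exp (x ^ 2 / 2) = 1 := fun x => by
    rw [← Real.exp_add]; simp; ring
  have hfb : ∀ x, |f x| ≤ 2 / (1 + |x|) := fun x => by
    have := mul_le_mul_of_nonneg_right (hub x) (Real.exp_pos (x ^ 2 / 2)).le
    rw [mul_assoc, hee] at this
    simpa [hf, abs_mul] using this
  have hfd : ∀ x, HasDerivAt f (x * f x + r x) x := fun x => by
    have h2 : HasDerivAt (fun t : ℝ => t ^ 2 / 2) x x := by
      exact ((hasDerivAt_pow 2 x).div_const 2).congr_deriv (by simp)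
    refine ((hud x).mul h2.exp).congr_deriv ?_
    simp only [hg, hf]
    rw [mul_assoc (r x), hee]
    ring
  have hf2 : ∀ x, |f x| ≤ 2 := fun x => (hfb x).trans <| by
    rw [div_le_iff₀ (by positivity)]; nlinarith [abs_nonneg x]
  have hxf : ∀ x : ℝ, |x| * (2 / (1 + |x|)) ≤ 2 := fun x => by
    rw [mul_div_assoc', div_le_iff₀ (by positivity)]; nlinarith [abs_nonneg x]
  set f' : ℝ → ℝ := fun x => x * f x + r x with hf'
  have hf'3 : ∀ x, |f' x| ≤ 3 := fun x => by
    have h2 : |x * f x| ≤ 2 := by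
      rw [abs_mul]
      exact (mul_le_mul_of_nonneg_left (hfb x) (abs_nonneg x)).trans (hxf x)
    calc |f' x| ≤ |x * f x| + |r x| := abs_add_le _ _
      _ ≤ 3 := by linarith [hr1 x]
  -- `f'` solves Stein's equation again, with right-hand side `f + h'`
  have hf'd : ∀ x, HasDerivAt f' (x * f' x + (f x + h' x)) x := fun x => by
    have h2 := ((hasDerivAt_id x).mul (hfd x)).add ((hd x).sub_const m)
    refine h2.congr_deriv ?_
    simp only [hf', id]; ring
  have hR : ∀ x, |f x + h' x| ≤ 2 + L := fun x =>
    (abs_add_le _ _).trans (add_le_add (hf2 x) (hL x))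
  have hL0 : 0 ≤ L := (abs_nonneg _).trans (hL 0)
  have hf'b := abs_le_of_stein hR hf'3 hf'd
  refine ⟨f, f', hfd, hf2, hf'3, fun x y => ?_, fun x => by simp only [hf', hr]; ring⟩
  have := Convex.norm_image_sub_le_of_norm_hasDerivWithin_le (s := Set.univ) (C := 6 + 3 * L)
    (fun x _ => (hf'd x).hasDerivWithinAt) (fun x _ => ?_) convex_univ (Set.mem_univ y)
    (Set.mem_univ x)
  · simpa using this
  · have h2 : |x * f' x| ≤ 2 * (2 + L) := by
      rw [abs_mul]
      refine (mul_le_mul_of_nonneg_left (hf'b x) (abs_nonneg x)).trans ?_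
      have := mul_le_mul_of_nonneg_left (hxf x) (show 0 ≤ 2 + L by linarith)
      calc |x| * (2 * (2 + L) / (1 + |x|)) = (2 + L) * (|x| * (2 / (1 + |x|))) := by ring
        _ ≤ _ := by linarith
    calc ‖x * f' x + (f x + h' x)‖ ≤ |x * f' x| + |f x + h' x| := abs_add_le _ _
      _ ≤ 6 + 3 * L := by linarith [hR x]

theorem exists_bound_deriv_smoothTransition : ∃ K : ℝ, 0 ≤ K ∧
    ∀ x, |deriv Real.smoothTransition x| ≤ K := by
  have hc : Continuous (deriv Real.smoothTransition) :=
    (Real.smoothTransition.contDiff (n := 1)).continuous_deriv le_rfl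
  obtain ⟨K, hK⟩ := isCompact_Icc.exists_bound_of_continuousOn (s := Set.Icc (0 : ℝ) 1)
    hc.continuousOn
  have hK0 : 0 ≤ K := (norm_nonneg _).trans (hK 0 (by simp))
  refine ⟨K, hK0, fun x => ?_⟩
  rcases lt_or_ge x 0 with hx | hx
  · have : Real.smoothTransition =ᶠ[𝓝 x] fun _ => 0 := by
      filter_upwards [Iio_mem_nhds hx] with t ht
      exact Real.smoothTransition.zero_of_nonpos ht.le
    rw [this.deriv_eq]; simpa using hK0
  rcases lt_or_ge 1 x with hx' | hx'
  · have : Real.smoothTransition =ᶠ[𝓝 x] fun _ => 1 := by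
      filter_upwards [Ioi_mem_nhds hx'] with t ht
      exact Real.smoothTransition.one_of_one_le ht.le
    rw [this.deriv_eq]; simpa using hK0
  · exact hK x ⟨hx, hx'⟩

theorem gaussianReal_Ioc_le (a δ : ℝ) (hδ : 0 ≤ δ) :
    (gaussianReal 0 1).real (Set.Ioc a (a + δ)) ≤ δ := by
  have h1 : ∀ x, gaussianPDFReal 0 1 x ≤ 1 := fun x => by
    simp only [gaussianPDFReal, NNReal.coe_one, mul_one, sub_zero]
    refine mul_le_one₀ (inv_le_one_of_one_le₀ ?_) (Real.exp_pos _).le (Real.exp_le_one_iff.2 ?_)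
    · rw [Real.one_le_sqrt]; nlinarith [Real.pi_gt_three]
    · nlinarith [sq_nonneg x]
  rw [measureReal_def, gaussianReal_apply_eq_integral 0 one_ne_zero,
    ENNReal.toReal_ofReal (integral_nonneg fun x => gaussianPDFReal_nonneg _ _ _)]
  calc ∫ x in Set.Ioc a (a + δ), gaussianPDFReal 0 1 x
      ≤ ∫ x in Set.Ioc a (a + δ), (1 : ℝ) :=
        integral_mono (integrable_gaussianPDFReal 0 1).restrict
          (integrable_const _) h1
    _ = δ := by simp [hδ]

/-- Stein's method for the Kolmogorov distance: a bound `η` for the Stein discrepancy over the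
solutions for test functions of slope `K / δ` gives the bound `δ + η` for the distribution
functions. -/
theorem exists_kolmogorov_le : ∃ K : ℝ, 0 ≤ K ∧ ∀ {Ω : Type} [MeasurableSpace Ω] (P : Measure Ω)
    [IsProbabilityMeasure P] (W : Ω → ℝ) (_ : IsBdd W) (δ η : ℝ), 0 < δ → δ ≤ 1 →
    (∀ f f' : ℝ → ℝ, (∀ x, HasDerivAt f (f' x) x) → (∀ x, |f x| ≤ 2) → (∀ x, |f' x| ≤ 3) →
      (∀ x y, |f' x - f' y| ≤ K / δ * |x - y|) →
      |∫ ω, (f' (W ω) - W ω * f (W ω)) ∂P| ≤ η) →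
    ∀ z, |P.real {ω | W ω ≤ z} - (gaussianReal 0 1).real (Set.Iic z)| ≤ δ + η := by
  obtain ⟨K, hK0, hK⟩ := exists_bound_deriv_smoothTransition
  refine ⟨6 + 3 * K, by positivity, ?_⟩
  intro Ω _ P _ W hW δ η hδ hδ1 hη z
  have key : ∀ a, ∃ h : ℝ → ℝ, Continuous h ∧ (∀ x, 0 ≤ h x) ∧ (∀ x, h x ≤ 1) ∧
      (∀ x, x ≤ a → h x = 1) ∧ (∀ x, a + δ ≤ x → h x = 0) ∧
      |∫ ω, h (W ω) ∂P - ∫ t, h t ∂(gaussianReal 0 1)| ≤ η := by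
    intro a
    set h : ℝ → ℝ := fun x => Real.smoothTransition ((a + δ - x) / δ) with hh
    have hd : ∀ x, HasDerivAt h (deriv Real.smoothTransition ((a + δ - x) / δ) * (-1 / δ)) x := by
      intro x
      have h1 : HasDerivAt (fun x => (a + δ - x) / δ) (-1 / δ) x := by
        simpa using ((hasDerivAt_id x).const_sub (a + δ)).div_const δ
      have h2 : HasDerivAt Real.smoothTransition
          (deriv Real.smoothTransition ((a + δ - x) / δ)) ((a + δ - x) / δ) :=
        ((Real.smoothTransition.contDiff (n := 1)).differentiable (by simp) _).hasDerivAt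
      exact h2.comp x h1
    have hc : Continuous h := continuous_iff_continuousAt.2 fun x => (hd x).continuousAt
    have h0 : ∀ x, 0 ≤ h x := fun x => Real.smoothTransition.nonneg _
    have h1 : ∀ x, h x ≤ 1 := fun x => Real.smoothTransition.le_one _
    have hL : ∀ x, |deriv Real.smoothTransition ((a + δ - x) / δ) * (-1 / δ)| ≤ K / δ := by
      intro x
      rw [abs_mul, abs_div, abs_neg, abs_one, abs_of_pos hδ, div_eq_mul_one_div K]
      exact mul_le_mul_of_nonneg_right (hK _) (by positivity)
    refine ⟨h, hc, h0, h1, fun x hx => ?_, fun x hx => ?_, ?_⟩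
    · refine Real.smoothTransition.one_of_one_le ?_
      rw [le_div_iff₀ hδ]; linarith
    · refine Real.smoothTransition.zero_of_nonpos (div_nonpos_of_nonpos_of_nonneg ?_ hδ.le)
      linarith
    obtain ⟨f, f', hf, hf2, hf3, hflip, heq⟩ := exists_stein_solution hd h0 h1 hL
    have h3 := hη f f' hf hf2 hf3 fun x y => (hflip x y).trans <| by
      refine mul_le_mul_of_nonneg_right ?_ (abs_nonneg _)
      rw [add_div, mul_div_assoc]
      have : 6 ≤ 6 / δ := by rw [le_div_iff₀ hδ]; linarith
      linarith
    simp only [heq] at h3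
    have hWi : Integrable (fun ω => h (W ω)) P :=
      Integrable.of_bound (hc.measurable.comp hW.1).aestronglyMeasurable 1
        (Eventually.of_forall fun ω => by
          rw [Real.norm_eq_abs, abs_of_nonneg (h0 _)]; exact h1 _)
    rw [integral_sub hWi (integrable_const _)] at h3
    simpa using h3
  have hbd : ∀ {Ω' : Type} [MeasurableSpace Ω'] (Q : Measure Ω') [IsProbabilityMeasure Q]
      (V : Ω' → ℝ) (_ : Measurable V) (h : ℝ → ℝ) (a : ℝ), Continuous h → (∀ x, 0 ≤ h x) →
      (∀ x, h x ≤ 1) → (∀ x, x ≤ a → h x = 1) → (∀ x, a + δ ≤ x → h x = 0) →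
      Q.real {ω | V ω ≤ a} ≤ ∫ ω, h (V ω) ∂Q ∧ ∫ ω, h (V ω) ∂Q ≤ Q.real {ω | V ω ≤ a + δ} := by
    intro Ω' _ Q _ V hV h a hc h0 h1 ha hb
    have hi : Integrable (fun ω => h (V ω)) Q :=
      Integrable.of_bound (hc.measurable.comp hV).aestronglyMeasurable 1
        (Eventually.of_forall fun ω => by
          rw [Real.norm_eq_abs, abs_of_nonneg (h0 _)]; exact h1 _)
    have hms : ∀ b, MeasurableSet {ω | V ω ≤ b} := fun b => hV measurableSet_Iic
    have hone : ∀ b, Integrable ({ω | V ω ≤ b}.indicator fun _ => (1 : ℝ)) Q := fun b =>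
      (integrable_const 1).indicator (hms b)
    rw [← integral_indicator_one (hms a), ← integral_indicator_one (hms (a + δ))]
    refine ⟨integral_mono (hone a) hi fun ω => ?_, integral_mono hi (hone (a + δ)) fun ω => ?_⟩
    · by_cases hω : V ω ≤ a
      · simp [Set.indicator, hω, ha _ hω]
      · simp [Set.indicator, hω, h0]
    · by_cases hω : V ω ≤ a + δ
      · simp [Set.indicator, hω, h1]
      · simp [Set.indicator, hω, hb _ (not_le.1 hω).le]
  have hgap : ∀ a, (gaussianReal 0 1).real (Set.Iic (a + δ))
      ≤ (gaussianReal 0 1).real (Set.Iic a) + δ := fun a => by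
    rw [← Set.Iic_union_Ioc_eq_Iic (show a ≤ a + δ by linarith)]
    exact (measureReal_union_le _ _).trans (by linarith [gaussianReal_Ioc_le a δ hδ.le])
  obtain ⟨h, hc, h0, h1, ha, hb, hη1⟩ := key z
  obtain ⟨k, kc, k0, k1, ka, kb, hη2⟩ := key (z - δ)
  have e1 := (hbd P W hW.1 h z hc h0 h1 ha hb).1
  have e2 := (hbd (gaussianReal 0 1) id measurable_id h z hc h0 h1 ha hb).2
  have e3 := (hbd P W hW.1 k (z - δ) kc k0 k1 ka kb).2
  have e4 := (hbd (gaussianReal 0 1) id measurable_id k (z - δ) kc k0 k1 ka kb).1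
  have e5 := hgap z
  have e6 := hgap (z - δ)
  rw [sub_add_cancel] at e3 e6
  simp only [id] at e2 e4
  change _ ≤ (gaussianReal 0 1).real (Set.Iic (z + δ)) at e2
  change (gaussianReal 0 1).real (Set.Iic (z - δ)) ≤ _ at e4
  rw [abs_le] at hη1 hη2 ⊢
  constructor <;> linarith [hη1.1, hη1.2, hη2.1, hη2.2]

end Stein

/-! ### Stein's discrepancy under local dependence -/

section LocalDependence

theorem abs_sub_sub_deriv_mul_le {f f' : ℝ → ℝ} {a : ℝ} (hf : ∀ x, HasDerivAt f (f' x) x)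
    (ha : 0 ≤ a) (hlip : ∀ x y, |f' x - f' y| ≤ a * |x - y|) (x h : ℝ) :
    |f x - f (x - h) - f' x * h| ≤ a * h ^ 2 := by
  have := Convex.norm_image_sub_le_of_norm_hasDerivWithin_le (s := Set.uIcc (x - h) x)
    (f := fun t => f t - f' x * t) (f' := fun t => f' t - f' x * 1) (C := a * |h|)
    (fun t _ => ((hf t).sub ((hasDerivAt_id t).const_mul (f' x))).hasDerivWithinAt)
    (fun t ht => ?_) (convex_uIcc _ _) Set.left_mem_uIcc Set.right_mem_uIcc
  · rw [Real.norm_eq_abs, Real.norm_eq_abs, sub_sub_cancel] at this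
    calc |f x - f (x - h) - f' x * h| = |f x - f' x * x - (f (x - h) - f' x * (x - h))| := by
          congr 1; ring
      _ ≤ a * |h| * |h| := this
      _ = a * h ^ 2 := by rw [mul_assoc, abs_mul_abs_self, sq]
  · rw [Real.norm_eq_abs, mul_one]
    refine (hlip t x).trans (mul_le_mul_of_nonneg_left ?_ ha)
    have h1 := Set.abs_sub_right_of_mem_uIcc ht
    rw [sub_sub_cancel] at h1
    rwa [abs_sub_comm]

theorem abs_integral_le_of_abs_le {Ω : Type*} [MeasurableSpace Ω] {P : Measure Ω}
    [IsProbabilityMeasure P] {g : Ω → ℝ} {C : ℝ} (h : ∀ ω, |g ω| ≤ C) : |∫ ω, g ω ∂P| ≤ C := by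
  have := norm_integral_le_of_norm_le_const (μ := P) (f := g) (C := C)
    (Filter.Eventually.of_forall h)
  simpa using this

theorem integral_abs_le_sqrt {Ω : Type*} [MeasurableSpace Ω] {P : Measure Ω}
    [IsProbabilityMeasure P] {g : Ω → ℝ} (hg : IsBdd g) :
    ∫ ω, |g ω| ∂P ≤ √(∫ ω, g ω ^ 2 ∂P) := by
  have ha : IsBdd fun ω => |g ω| := ⟨hg.1.abs, hg.2.imp fun C hC y => by rw [abs_abs]; exact hC y⟩
  have hg2 : IsBdd fun ω => g ω ^ 2 := by simpa only [sq] using hg.mul hg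
  refine Real.le_sqrt_of_sq_le ?_
  set m := ∫ ω, |g ω| ∂P with hm
  have h1 : 0 ≤ ∫ ω, (|g ω| - m) ^ 2 ∂P := integral_nonneg fun ω => sq_nonneg _
  have h2 : (fun ω => (|g ω| - m) ^ 2) = fun ω => (g ω ^ 2 - 2 * m * |g ω|) + m ^ 2 := by
    funext ω; rw [sub_sq, sq_abs]; ring
  rw [h2, integral_add ((hg2.sub (ha.const_mul _)).integrable _) (integrable_const _),
    integral_sub (hg2.integrable _) ((ha.const_mul _).integrable _), integral_const_mul, ← hm] at h1
  simp at h1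
  nlinarith

variable {Ω ι : Type*} [MeasurableSpace Ω] {P : Measure Ω} [IsProbabilityMeasure P] [Fintype ι]
  [DecidableEq ι] {X : ι → Ω → ℝ} {B B' : ι → Finset ι} {n n' : ℕ} {s η : ℝ}

theorem abs_sum_le_card {Y : ι → ℝ} (h : ∀ i, |Y i| ≤ 1) (t : Finset ι) :
    |∑ i ∈ t, Y i| ≤ t.card := by
  refine (Finset.abs_sum_le_sum_abs _ _).trans ((Finset.sum_le_sum fun i _ => h i).trans ?_)
  simp

/-- The local quadratic form `∑ᵢ Xᵢ ∑_{j ∈ B i} Xⱼ` has fluctuations of the order of the square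
root of the number of summands when distant products are nearly uncorrelated. -/
theorem integral_sq_local_le (hX : ∀ i, Measurable (X i)) (hX1 : ∀ i ω, |X i ω| ≤ 1)
    (hB : ∀ i, (B i).card ≤ n) (hB' : ∀ i, (B' i).card ≤ n') (hη : 0 ≤ η)
    (h3 : ∀ i l, l ∉ B' i → ∀ j ∈ B i, ∀ m ∈ B l,
      |∫ ω, (X i ω * X j ω) * (X l ω * X m ω) ∂P
        - (∫ ω, X i ω * X j ω ∂P) * ∫ ω, X l ω * X m ω ∂P| ≤ η) :
    ∫ ω, (∑ i, ∑ j ∈ B i, (X i ω * X j ω - ∫ ω', X i ω' * X j ω' ∂P)) ^ 2 ∂P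
      ≤ Fintype.card ι * n ^ 2 * (4 * n' + Fintype.card ι * η) := by
  have hXb : ∀ i, IsBdd (X i) := fun i => IsBdd.of_le (hX i) (hX1 i)
  have hXX : ∀ i j, IsBdd fun ω => X i ω * X j ω := fun i j => (hXb i).mul (hXb j)
  have hXX1 : ∀ i j ω, |X i ω * X j ω| ≤ 1 := fun i j ω => by
    rw [abs_mul]; exact mul_le_one₀ (hX1 i ω) (abs_nonneg _) (hX1 j ω)
  set e : ι → ι → ℝ := fun i j => ∫ ω, X i ω * X j ω ∂P with he
  have he1 : ∀ i j, |e i j| ≤ 1 := fun i j => abs_integral_le_of_abs_le (hXX1 i j)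
  set Z : ι → ι → Ω → ℝ := fun i j ω => X i ω * X j ω - e i j with hZ
  have hZb : ∀ i j, IsBdd (Z i j) := fun i j => (hXX i j).sub (isBdd_const _)
  have hZ2 : ∀ i j ω, |Z i j ω| ≤ 2 := fun i j ω =>
    (abs_sub _ _).trans (by linarith [hXX1 i j ω, he1 i j])
  have hcov : ∀ i j l m, ∫ ω, Z i j ω * Z l m ω ∂P
      = ∫ ω, (X i ω * X j ω) * (X l ω * X m ω) ∂P - e i j * e l m := fun i j l m => by
    have h1 : (fun ω => Z i j ω * Z l m ω) = fun ω => ((X i ω * X j ω) * (X l ω * X m ω)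
        - e l m * (X i ω * X j ω)) - (e i j * (X l ω * X m ω) - e i j * e l m) := by
      funext ω; simp only [hZ]; ring
    rw [h1, integral_sub ((((hXX i j).mul (hXX l m)).sub ((hXX i j).const_mul _)).integrable _)
        ((((hXX l m).const_mul _).sub (isBdd_const _)).integrable _),
      integral_sub (((hXX i j).mul (hXX l m)).integrable _) (((hXX i j).const_mul _).integrable _),
      integral_sub (((hXX l m).const_mul _).integrable _) (integrable_const _),
      integral_const_mul, integral_const_mul]
    simp [he]; ring
  have hsq : (fun ω => (∑ i, ∑ j ∈ B i, Z i j ω) ^ 2)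
      = fun ω => ∑ i, ∑ l, ∑ j ∈ B i, ∑ m ∈ B l, Z i j ω * Z l m ω := by
    funext ω
    simp only [sq, Finset.sum_mul_sum]
  have hb4 : ∀ i j l m, IsBdd fun ω => Z i j ω * Z l m ω := fun i j l m => (hZb i j).mul (hZb l m)
  have hint : ∫ ω, (∑ i, ∑ j ∈ B i, Z i j ω) ^ 2 ∂P
      = ∑ i, ∑ l, ∑ j ∈ B i, ∑ m ∈ B l, ∫ ω, Z i j ω * Z l m ω ∂P := by
    rw [hsq, integral_finsetSum _ fun i _ => (IsBdd.sum _ fun l _ => IsBdd.sum _ fun j _ =>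
      IsBdd.sum _ fun m _ => hb4 i j l m).integrable _]
    refine Finset.sum_congr rfl fun i _ => ?_
    rw [integral_finsetSum _ fun l _ => (IsBdd.sum _ fun j _ =>
      IsBdd.sum _ fun m _ => hb4 i j l m).integrable _]
    refine Finset.sum_congr rfl fun l _ => ?_
    rw [integral_finsetSum _ fun j _ => (IsBdd.sum _ fun m _ => hb4 i j l m).integrable _]
    refine Finset.sum_congr rfl fun j _ => ?_
    rw [integral_finsetSum _ fun m _ => (hb4 i j l m).integrable _]
  have hterm : ∀ i l, ∑ j ∈ B i, ∑ m ∈ B l, ∫ ω, Z i j ω * Z l m ω ∂P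
      ≤ n ^ 2 * ((if l ∈ B' i then 4 else 0) + η) := by
    intro i l
    have hc : ∀ j ∈ B i, ∀ m ∈ B l,
        ∫ ω, Z i j ω * Z l m ω ∂P ≤ (if l ∈ B' i then 4 else 0) + η := by
      intro j hj m hm
      split_ifs with hl
      · have : |∫ ω, Z i j ω * Z l m ω ∂P| ≤ 4 := abs_integral_le_of_abs_le fun ω => by
          rw [abs_mul]
          have := mul_le_mul (hZ2 i j ω) (hZ2 l m ω) (abs_nonneg _) zero_le_two
          linarith
        linarith [le_abs_self (∫ ω, Z i j ω * Z l m ω ∂P)]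
      · rw [hcov, zero_add]
        exact (le_abs_self _).trans (h3 i l hl j hj m hm)
    set c : ℝ := (if l ∈ B' i then 4 else 0) + η
    have hc0 : 0 ≤ c := by simp only [c]; split_ifs <;> linarith
    calc ∑ j ∈ B i, ∑ m ∈ B l, ∫ ω, Z i j ω * Z l m ω ∂P
        ≤ ∑ j ∈ B i, ∑ m ∈ B l, c :=
          Finset.sum_le_sum fun j hj => Finset.sum_le_sum fun m hm => hc j hj m hm
      _ = (B i).card * ((B l).card * c) := by simp
      _ ≤ n * (n * c) := by
          have h1 : ((B i).card : ℝ) ≤ n := by exact_mod_cast hB i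
          have h2 : ((B l).card : ℝ) ≤ n := by exact_mod_cast hB l
          gcongr
      _ = n ^ 2 * c := by ring
  rw [hint]
  calc ∑ i, ∑ l, ∑ j ∈ B i, ∑ m ∈ B l, ∫ ω, Z i j ω * Z l m ω ∂P
      ≤ ∑ i, ∑ l, (n : ℝ) ^ 2 * ((if l ∈ B' i then 4 else 0) + η) :=
        Finset.sum_le_sum fun i _ => Finset.sum_le_sum fun l _ => hterm i l
    _ = ∑ i, (n : ℝ) ^ 2 * (4 * (B' i).card + Fintype.card ι * η) := by
        refine Finset.sum_congr rfl fun i _ => ?_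
        rw [← Finset.mul_sum, Finset.sum_add_distrib]
        simp [Finset.sum_ite_mem, mul_comm]
    _ ≤ ∑ _i : ι, (n : ℝ) ^ 2 * (4 * n' + Fintype.card ι * η) := by
        refine Finset.sum_le_sum fun i _ => ?_
        have h1 : ((B' i).card : ℝ) ≤ n' := by exact_mod_cast hB' i
        gcongr
    _ = _ := by simp; ring

/-- Stein's discrepancy of a normalised sum of bounded variables with local dependence: `η`
bounds the residual correlation of `i` with the outside of its neighbourhood `B i`, and of products
over `B i` with products over `B l` when `l` is outside of the larger neighbourhood `B' i`. -/
theorem abs_stein_discrepancy_le (hX : ∀ i, Measurable (X i)) (hX1 : ∀ i ω, |X i ω| ≤ 1)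
    (hB : ∀ i, (B i).card ≤ n) (hB' : ∀ i, (B' i).card ≤ n') (hη : 0 ≤ η) (hs : 0 < s)
    (hvar : s ^ 2 = ∫ ω, (∑ i, X i ω) ^ 2 ∂P)
    (h1 : ∀ i, ∀ φ : ℝ → ℝ, Measurable φ → (∀ x, |φ x| ≤ 1) →
      |∫ ω, X i ω * φ (∑ j ∈ (B i)ᶜ, X j ω) ∂P| ≤ η)
    (h2 : ∀ i, ∀ j ∉ B i, |∫ ω, X i ω * X j ω ∂P| ≤ η)
    (h3 : ∀ i l, l ∉ B' i → ∀ j ∈ B i, ∀ m ∈ B l,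
      |∫ ω, (X i ω * X j ω) * (X l ω * X m ω) ∂P
        - (∫ ω, X i ω * X j ω ∂P) * ∫ ω, X l ω * X m ω ∂P| ≤ η)
    {f f' : ℝ → ℝ} {a : ℝ} (ha : 0 ≤ a) (hf : ∀ x, HasDerivAt f (f' x) x)
    (hf2 : ∀ x, |f x| ≤ 2) (hf3 : ∀ x, |f' x| ≤ 3)
    (hlip : ∀ x y, |f' x - f' y| ≤ a * |x - y|) :
    |∫ ω, (f' ((∑ i, X i ω) / s) - (∑ i, X i ω) / s * f ((∑ i, X i ω) / s)) ∂P|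
      ≤ 3 / s ^ 2 * (Fintype.card ι ^ 2 * η
          + √(Fintype.card ι * n ^ 2 * (4 * n' + Fintype.card ι * η)))
        + 2 / s * (Fintype.card ι * η) + a * (Fintype.card ι * n ^ 2) / s ^ 3 := by
  have hXb : ∀ i, IsBdd (X i) := fun i => IsBdd.of_le (hX i) (hX1 i)
  have hXX : ∀ i j, IsBdd fun ω => X i ω * X j ω := fun i j => (hXb i).mul (hXb j)
  set S : Ω → ℝ := fun ω => ∑ i, X i ω with hS
  have hSb : IsBdd S := IsBdd.sum _ fun i _ => hXb i
  set W : ι → Ω → ℝ := fun i ω => ∑ j ∈ B i, X j ω with hW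
  have hWb : ∀ i, IsBdd (W i) := fun i => IsBdd.sum _ fun j _ => hXb j
  have hSW : ∀ i ω, S ω - W i ω = ∑ j ∈ (B i)ᶜ, X j ω := fun i ω => by
    simp only [hS, hW, ← Finset.sum_add_sum_compl (B i)]; ring
  have hWn : ∀ i ω, |W i ω| ≤ n := fun i ω =>
    (abs_sum_le_card (fun j => hX1 j ω) (B i)).trans (by exact_mod_cast hB i)
  set T : Ω → ℝ := fun ω => ∑ i, X i ω * W i ω with hT
  have hTb : IsBdd T := IsBdd.sum _ fun i _ => (hXb i).mul (hWb i)
  have hfc : Continuous f := continuous_iff_continuousAt.2 fun x => (hf x).continuousAt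
  have hf'c : Continuous f' := by
    have : LipschitzWith a.toNNReal f' := LipschitzWith.of_dist_le_mul fun x y => by
      rw [Real.dist_eq, Real.dist_eq, Real.coe_toNNReal a ha]; exact hlip x y
    exact this.continuous
  set D : Ω → ℝ := fun ω => f' (S ω / s) * (1 - T ω / s ^ 2) with hD
  set G : Ω → ℝ := fun ω => 1 / s * ∑ i, X i ω * f ((S ω - W i ω) / s) with hG
  set R : Ω → ℝ := fun ω => 1 / s * ∑ i, X i ω *
    (f (S ω / s) - f (S ω / s - W i ω / s) - f' (S ω / s) * (W i ω / s)) with hR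
  have hfm : ∀ g : Ω → ℝ, Measurable g → IsBdd fun ω => f (g ω) := fun g hg =>
    IsBdd.of_le (hfc.measurable.comp hg) fun _ => hf2 _
  have hf'b : IsBdd fun ω => f' (S ω / s) :=
    IsBdd.of_le (hf'c.measurable.comp (hSb.1.div_const s)) fun _ => hf3 _
  have hTs : IsBdd fun ω => 1 - T ω / s ^ 2 := by
    simpa only [div_eq_inv_mul] using (isBdd_const 1).sub (hTb.const_mul (s ^ 2)⁻¹)
  have hDb : IsBdd D := hf'b.mul hTs
  have hGb : IsBdd G := (IsBdd.sum _ fun i _ => (hXb i).mul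
    (hfm _ ((hSb.1.sub (hWb i).1).div_const s))).const_mul _
  have hRb : IsBdd R := by
    refine (IsBdd.sum _ fun i _ => (hXb i).mul (((hfm _ (hSb.1.div_const s)).sub
      (hfm _ ((hSb.1.div_const s).sub ((hWb i).1.div_const s)))).sub (hf'b.mul ?_))).const_mul _
    simpa only [div_eq_inv_mul] using (hWb i).const_mul s⁻¹
  have hdecomp : ∀ ω, f' (S ω / s) - S ω / s * f (S ω / s) = D ω - G ω - R ω := by
    intro ω
    have e1 : S ω / s * f (S ω / s) = 1 / s * ∑ i, X i ω * f (S ω / s) := by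
      rw [← Finset.sum_mul]; ring
    have e2 : f' (S ω / s) * (T ω / s ^ 2)
        = 1 / s * ∑ i, X i ω * (f' (S ω / s) * (W i ω / s)) := by
      simp only [hT, Finset.mul_sum, Finset.sum_div]
      refine Finset.sum_congr rfl fun i _ => ?_
      field_simp
    have e3 : G ω + R ω + f' (S ω / s) * (T ω / s ^ 2) = S ω / s * f (S ω / s) := by
      rw [e1, e2]
      simp only [hG, hR]
      rw [← mul_add, ← mul_add, ← Finset.sum_add_distrib, ← Finset.sum_add_distrib]
      refine congrArg _ (Finset.sum_congr rfl fun i _ => ?_)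
      rw [sub_div]; ring
    simp only [hD]
    linarith
  have hIG : |∫ ω, G ω ∂P| ≤ 2 / s * (Fintype.card ι * η) := by
    simp only [hG]
    have e0 : ∀ i, IsBdd fun ω => X i ω * f ((S ω - W i ω) / s) := fun i =>
      (hXb i).mul (hfm _ ((hSb.1.sub (hWb i).1).div_const s))
    rw [integral_const_mul, integral_finsetSum _ fun i _ => (e0 i).integrable _, abs_mul,
      abs_of_pos (show 0 < 1 / s by positivity)]
    have e1 : ∀ i, |∫ ω, X i ω * f ((S ω - W i ω) / s) ∂P| ≤ 2 * η := by
      intro i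
      have := h1 i (fun x => 1 / 2 * f (x / s))
        ((hfc.measurable.comp (measurable_id.div_const s)).const_mul _) fun x => by
          rw [abs_mul, abs_of_pos (by norm_num : (0 : ℝ) < 1 / 2)]; linarith [hf2 (x / s)]
      have e2 : ∀ ω, X i ω * f ((S ω - W i ω) / s)
          = 2 * (X i ω * (1 / 2 * f ((∑ j ∈ (B i)ᶜ, X j ω) / s))) := fun ω => by
        rw [hSW]; ring
      simp only [e2]
      rw [integral_const_mul, abs_mul, abs_two]
      linarith
    calc 1 / s * |∑ i, ∫ ω, X i ω * f ((S ω - W i ω) / s) ∂P|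
        ≤ 1 / s * ∑ _i : ι, 2 * η := by
          refine mul_le_mul_of_nonneg_left ?_ (by positivity)
          exact (Finset.abs_sum_le_sum_abs _ _).trans (Finset.sum_le_sum fun i _ => e1 i)
      _ = 2 / s * (Fintype.card ι * η) := by simp; ring
  have hIR : |∫ ω, R ω ∂P| ≤ a * (Fintype.card ι * n ^ 2) / s ^ 3 := by
    refine abs_integral_le_of_abs_le fun ω => ?_
    simp only [hR]
    rw [abs_mul, abs_of_pos (show 0 < 1 / s by positivity)]
    have e1 : ∀ i, |X i ω * (f (S ω / s) - f (S ω / s - W i ω / s) - f' (S ω / s) * (W i ω / s))|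
        ≤ a * n ^ 2 / s ^ 2 := by
      intro i
      rw [abs_mul]
      refine (mul_le_of_le_one_left (abs_nonneg _) (hX1 i ω)).trans ?_
      refine (abs_sub_sub_deriv_mul_le hf ha hlip _ _).trans ?_
      rw [div_pow, mul_div_assoc]
      have : W i ω ^ 2 ≤ (n : ℝ) ^ 2 := sq_le_sq' (abs_le.1 (hWn i ω)).1 (abs_le.1 (hWn i ω)).2
      gcongr
    calc _ ≤ 1 / s * ∑ _i : ι, a * n ^ 2 / s ^ 2 := by
          refine mul_le_mul_of_nonneg_left ?_ (by positivity)
          exact (Finset.abs_sum_le_sum_abs _ _).trans (Finset.sum_le_sum fun i _ => e1 i)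
      _ = _ := by simp; field_simp
  have hT0 : |s ^ 2 - ∫ ω, T ω ∂P| ≤ Fintype.card ι ^ 2 * η := by
    have e1 : ∀ ω, S ω ^ 2 - T ω = ∑ i, ∑ j ∈ (B i)ᶜ, X i ω * X j ω := fun ω => by
      simp only [hT, ← Finset.mul_sum, ← hSW]
      have : S ω ^ 2 = ∑ i, X i ω * S ω := by rw [← Finset.sum_mul, sq]
      rw [this, ← Finset.sum_sub_distrib]
      exact Finset.sum_congr rfl fun i _ => by ring
    rw [hvar, ← integral_sub ((by simpa only [sq] using hSb.mul hSb :
      IsBdd fun ω => S ω ^ 2).integrable _) (hTb.integrable _)]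
    simp only [e1]
    rw [integral_finsetSum _ fun i _ => (IsBdd.sum _ fun j _ => hXX i j).integrable _]
    have e2 : ∀ i, |∫ ω, ∑ j ∈ (B i)ᶜ, X i ω * X j ω ∂P| ≤ Fintype.card ι * η := by
      intro i
      rw [integral_finsetSum _ fun j _ => (hXX i j).integrable _]
      refine (Finset.abs_sum_le_sum_abs _ _).trans
        ((Finset.sum_le_sum fun j hj => h2 i j (by simpa using hj)).trans ?_)
      rw [Finset.sum_const, nsmul_eq_mul]
      exact mul_le_mul_of_nonneg_right (by exact_mod_cast Finset.card_le_univ _) hη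
    refine (Finset.abs_sum_le_sum_abs _ _).trans ((Finset.sum_le_sum fun i _ => e2 i).trans ?_)
    simp only [Finset.sum_const, Finset.card_univ, nsmul_eq_mul]
    exact le_of_eq (by ring)
  have hTv : ∫ ω, |T ω - ∫ ω', T ω' ∂P| ∂P
      ≤ √(Fintype.card ι * n ^ 2 * (4 * n' + Fintype.card ι * η)) := by
    have e1 : ∫ ω, T ω ∂P = ∑ i, ∑ j ∈ B i, ∫ ω, X i ω * X j ω ∂P := by
      simp only [hT, hW, Finset.mul_sum]
      rw [integral_finsetSum _ fun i _ => (IsBdd.sum _ fun j _ => hXX i j).integrable _]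
      refine Finset.sum_congr rfl fun i _ => ?_
      rw [integral_finsetSum _ fun j _ => (hXX i j).integrable _]
    have e2 : ∀ ω, T ω - ∫ ω', T ω' ∂P
        = ∑ i, ∑ j ∈ B i, (X i ω * X j ω - ∫ ω', X i ω' * X j ω' ∂P) := fun ω => by
      rw [e1]
      simp only [hT, hW, Finset.mul_sum, Finset.sum_sub_distrib]
    refine (integral_abs_le_sqrt (hTb.sub (isBdd_const _))).trans (Real.sqrt_le_sqrt ?_)
    simp only [e2]
    exact integral_sq_local_le hX hX1 hB hB' hη h3
  have hID : |∫ ω, D ω ∂P| ≤ 3 / s ^ 2 * (Fintype.card ι ^ 2 * η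
      + √(Fintype.card ι * n ^ 2 * (4 * n' + Fintype.card ι * η))) := by
    have habs : IsBdd fun ω => |T ω - ∫ ω', T ω' ∂P| := by
      have := hTb.sub (isBdd_const (∫ ω', T ω' ∂P))
      exact ⟨this.1.abs, this.2.imp fun C hC y => by rw [abs_abs]; exact hC y⟩
    have e1 : ∀ ω, |D ω| ≤ 3 / s ^ 2 * (Fintype.card ι ^ 2 * η + |T ω - ∫ ω', T ω' ∂P|) := by
      intro ω
      have e2 : 1 - T ω / s ^ 2
          = 1 / s ^ 2 * ((s ^ 2 - ∫ ω', T ω' ∂P) - (T ω - ∫ ω', T ω' ∂P)) := by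
        field_simp; ring
      simp only [hD]
      rw [abs_mul, e2, abs_mul, abs_of_pos (show 0 < 1 / s ^ 2 by positivity)]
      have e3 := (abs_sub (s ^ 2 - ∫ ω', T ω' ∂P) (T ω - ∫ ω', T ω' ∂P)).trans
        (add_le_add_left hT0 _)
      calc _ ≤ 3 * (1 / s ^ 2 * (Fintype.card ι ^ 2 * η + |T ω - ∫ ω', T ω' ∂P|)) := by
            refine mul_le_mul (hf3 _) (mul_le_mul_of_nonneg_left e3 (by positivity))
              (by positivity) (by norm_num)
        _ = _ := by ring
    calc |∫ ω, D ω ∂P| ≤ ∫ ω, |D ω| ∂P := abs_integral_le_integral_abs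
      _ ≤ ∫ ω, 3 / s ^ 2 * (Fintype.card ι ^ 2 * η + |T ω - ∫ ω', T ω' ∂P|) ∂P :=
          integral_mono (hDb.integrable _).abs
            ((((isBdd_const _).add habs).const_mul _).integrable _) e1
      _ = 3 / s ^ 2 * (Fintype.card ι ^ 2 * η + ∫ ω, |T ω - ∫ ω', T ω' ∂P| ∂P) := by
          rw [integral_const_mul, integral_add (integrable_const _) (habs.integrable _)]
          simp
      _ ≤ _ := by
          refine mul_le_mul_of_nonneg_left ?_ (by positivity)
          linarith
  have hfin : ∫ ω, (f' (S ω / s) - S ω / s * f (S ω / s)) ∂P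
      = ∫ ω, D ω ∂P - ∫ ω, G ω ∂P - ∫ ω, R ω ∂P := by
    simp only [hdecomp]
    rw [integral_sub ((hDb.sub hGb).integrable _) (hRb.integrable _),
      integral_sub (hDb.integrable _) (hGb.integrable _)]
  rw [hfin]
  calc _ ≤ |∫ ω, D ω ∂P| + |∫ ω, G ω ∂P| + |∫ ω, R ω ∂P| :=
        (abs_sub _ _).trans (add_le_add_left (abs_sub _ _) _)
    _ ≤ _ := add_le_add (add_le_add hID hIG) hIR

end LocalDependence

/-! ### The rate for Gibbs laws on cycles -/

section Rates

open Filter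

/-- A geometric factor over half a window of length `N ^ ε` beats any fixed power of `N`. -/
theorem exists_sq_mul_pow_le {ρ ε : ℝ} (h0 : 0 ≤ ρ) (h1 : ρ < 1) (hε : 0 < ε) :
    ∃ A : ℝ, 0 ≤ A ∧ ∀ N : ℕ, 1 ≤ N →
      (N : ℝ) ^ 2 * (4 * ρ ^ (⌊(N : ℝ) ^ ε⌋₊ / 2)) ≤ A := by
  set p : ℕ := ⌈2 / ε⌉₊
  obtain ⟨A₀, hA₀⟩ := (tendsto_pow_const_mul_const_pow_of_abs_lt_one p
    (by rwa [abs_of_nonneg h0] : |ρ| < 1)).bddAbove_range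
  have hA₀' : ∀ j : ℕ, (j : ℝ) ^ p * ρ ^ j ≤ A₀ := fun j => hA₀ ⟨j, rfl⟩
  have hA₀0 : 0 ≤ A₀ := le_trans (by positivity) (hA₀' 0)
  have hj : ∀ j : ℕ, ((j : ℝ) + 1) ^ p * ρ ^ j ≤ 2 ^ p * A₀ + 1 := by
    intro j
    rcases Nat.eq_zero_or_pos j with rfl | hj
    · have : (0 : ℝ) ≤ 2 ^ p * A₀ := by positivity
      simp; linarith
    · have hj1 : (1 : ℝ) ≤ j := by exact_mod_cast hj
      calc ((j : ℝ) + 1) ^ p * ρ ^ j ≤ (2 * j) ^ p * ρ ^ j := by gcongr; linarith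
        _ = 2 ^ p * ((j : ℝ) ^ p * ρ ^ j) := by rw [mul_pow]; ring
        _ ≤ 2 ^ p * A₀ := mul_le_mul_of_nonneg_left (hA₀' j) (by positivity)
        _ ≤ _ := by linarith
  refine ⟨4 * 2 ^ p * (2 ^ p * A₀ + 1), by positivity, fun N hN => ?_⟩
  have hN1 : (1 : ℝ) ≤ N := by exact_mod_cast hN
  set t : ℝ := (N : ℝ) ^ ε with ht
  set j := ⌊t⌋₊ / 2 with hjdef
  have ht1 : 1 ≤ t := Real.one_le_rpow hN1 hε.le
  have htj : t ≤ 2 * ((j : ℝ) + 1) := by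
    have h2 : t < (⌊t⌋₊ : ℝ) + 1 := Nat.lt_floor_add_one t
    have h3 : ⌊t⌋₊ + 1 ≤ 2 * (j + 1) := by omega
    have h4 : ((⌊t⌋₊ : ℝ) + 1) ≤ 2 * ((j : ℝ) + 1) := by exact_mod_cast h3
    linarith
  have hN2 : (N : ℝ) ^ 2 ≤ t ^ p := by
    have h2 : (N : ℝ) ^ 2 = t ^ (2 / ε) := by
      rw [ht, ← Real.rpow_mul (by linarith), mul_div_cancel₀ _ hε.ne']
      norm_num
    rw [h2, ← Real.rpow_natCast]
    exact Real.rpow_le_rpow_of_exponent_le ht1 (Nat.le_ceil _)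
  calc (N : ℝ) ^ 2 * (4 * ρ ^ j) ≤ (2 * ((j : ℝ) + 1)) ^ p * (4 * ρ ^ j) := by
        refine mul_le_mul_of_nonneg_right (hN2.trans ?_) (by positivity)
        gcongr
    _ = 4 * 2 ^ p * (((j : ℝ) + 1) ^ p * ρ ^ j) := by rw [mul_pow]; ring
    _ ≤ _ := mul_le_mul_of_nonneg_left (hj j) (by positivity)

/-- The bookkeeping of the error terms, with `N = w ^ 4`, windows of size `t` and the smoothing
scale `t / w`. -/
theorem error_terms_le {r A K t w s η n n' N : ℝ} (hr : 0 < r) (hA : 0 ≤ A) (hK : 0 ≤ K)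
    (ht : 1 ≤ t) (htw : t ≤ w) (hN : N = w ^ 4) (hs : r * w ^ 2 ≤ s) (hn0 : 0 ≤ n)
    (hn : n ≤ 4 * t) (hn' : n' ≤ 8 * t) (hη : 0 ≤ η) (hNη : N ^ 2 * η ≤ A) :
    t / w + (3 / s ^ 2 * (N ^ 2 * η + √(N * n ^ 2 * (4 * n' + N * η)))
        + 2 / s * (N * η) + K / (t / w) * (N * n ^ 2) / s ^ 3)
      ≤ (1 + 3 * A / r ^ 2 + 12 * √(32 + A) / r ^ 2 + 2 * A / r + 16 * K / r ^ 3) * (t / w) := by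
  have hw : 1 ≤ w := ht.trans htw
  have hw0 : 0 < w := by linarith
  have ht0 : 0 < t := by linarith
  have hs0 : 0 < s := lt_of_lt_of_le (by positivity) hs
  have hs2 : r ^ 2 * w ^ 4 ≤ s ^ 2 := by
    calc r ^ 2 * w ^ 4 = (r * w ^ 2) ^ 2 := by ring
      _ ≤ s ^ 2 := by gcongr
  have hs3 : r ^ 3 * w ^ 6 ≤ s ^ 3 := by
    calc r ^ 3 * w ^ 6 = (r * w ^ 2) ^ 3 := by ring
      _ ≤ s ^ 3 := by gcongr
  have hN1 : 1 ≤ N := by rw [hN]; exact one_le_pow₀ hw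
  have hNη' : N * η ≤ A := by
    refine le_trans ?_ hNη
    rw [sq, mul_assoc]
    exact le_mul_of_one_le_left (by positivity) hN1
  have hinv : 1 / w ≤ t / w := by gcongr
  have e1 : 3 / s ^ 2 * (N ^ 2 * η) ≤ 3 * A / r ^ 2 * (t / w) := by
    calc 3 / s ^ 2 * (N ^ 2 * η) ≤ 3 / (r ^ 2 * w ^ 4) * A := by gcongr
      _ = 3 * A / r ^ 2 * (1 / w ^ 4) := by field_simp
      _ ≤ 3 * A / r ^ 2 * (1 / w) := by
          gcongr
          exact le_self_pow₀ hw (by norm_num)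
      _ ≤ _ := by gcongr
  have e2 : 3 / s ^ 2 * √(N * n ^ 2 * (4 * n' + N * η)) ≤ 12 * √(32 + A) / r ^ 2 * (t / w) := by
    have h1 : N * n ^ 2 * (4 * n' + N * η) ≤ (32 + A) * (4 * (w ^ 3 * t)) ^ 2 := by
      calc N * n ^ 2 * (4 * n' + N * η) ≤ w ^ 4 * (4 * t) ^ 2 * (32 * t + A * t) := by
            rw [hN]
            have : 4 * n' + w ^ 4 * η ≤ 32 * t + A * t := by
              rw [← hN]
              have := le_mul_of_one_le_right hA ht
              linarith
            refine mul_le_mul_of_nonneg_left this (by positivity) |>.trans ?_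
            gcongr
        _ = (32 + A) * (16 * (w ^ 4 * t ^ 2)) * t := by ring
        _ ≤ (32 + A) * (16 * (w ^ 4 * t ^ 2)) * w ^ 2 := by
            refine mul_le_mul_of_nonneg_left ?_ (by positivity)
            exact htw.trans (le_self_pow₀ hw (by norm_num))
        _ = _ := by ring
    have h2 : √(N * n ^ 2 * (4 * n' + N * η)) ≤ √(32 + A) * (4 * (w ^ 3 * t)) := by
      refine (Real.sqrt_le_sqrt h1).trans (le_of_eq ?_)
      rw [Real.sqrt_mul (by positivity), Real.sqrt_sq (by positivity)]
    calc _ ≤ 3 / (r ^ 2 * w ^ 4) * (√(32 + A) * (4 * (w ^ 3 * t))) := by gcongr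
      _ = _ := by field_simp; ring
  have e3 : 2 / s * (N * η) ≤ 2 * A / r * (t / w) := by
    calc 2 / s * (N * η) ≤ 2 / (r * w ^ 2) * A := by gcongr
      _ = 2 * A / r * (1 / w ^ 2) := by field_simp
      _ ≤ 2 * A / r * (1 / w) := by
          gcongr
          exact le_self_pow₀ hw (by norm_num)
      _ ≤ _ := by gcongr
  have e4 : K / (t / w) * (N * n ^ 2) / s ^ 3 ≤ 16 * K / r ^ 3 * (t / w) := by
    calc K / (t / w) * (N * n ^ 2) / s ^ 3
        ≤ K / (t / w) * (w ^ 4 * (4 * t) ^ 2) / (r ^ 3 * w ^ 6) := by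
          rw [hN]; gcongr
      _ = _ := by field_simp; ring
  rw [mul_add (3 / s ^ 2)]
  linarith

end Rates

namespace Model

variable {X : Type} [MeasurableSpace X] (M : Model X) {v : X → ℝ}

/-- A Berry–Esseen bound for the Gibbs laws `Q` of a model on cycles. -/
theorem exists_berry_esseen (hv : Measurable v) (h0 : ∀ x, 0 ≤ v x) (h1 : ∀ x, v x ≤ 1)
    (hV : 0 < M.minorVar v) {ε : ℝ} (hε : 0 < ε) (hε' : ε < 1 / 4) :
    ∃ C : ℝ, ∀ (N : ℕ) [NeZero N] (Q : Measure (Fin N → X)) [IsProbabilityMeasure Q],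
      (∀ φ : (Fin N → X) → ℝ, IsBdd φ → ∫ y, φ y ∂Q = M.avg φ) →
      ∀ s : ℝ, 0 < s → s ^ 2 = ∫ y, (∑ i, (v (y i) - ∫ y', v (y' i) ∂Q)) ^ 2 ∂Q →
      ∀ z : ℝ, |Q.real {y | (∑ i, (v (y i) - ∫ y', v (y' i) ∂Q)) / s ≤ z}
        - (gaussianReal 0 1).real (Set.Iic z)| ≤ C * (N : ℝ) ^ (-(1 / 4 : ℝ) + ε) := by
  obtain ⟨K, hK0, hK⟩ := exists_kolmogorov_le
  have hm0 := M.minor_pos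
  have hm1 := M.minor_le
  set ρ := 1 - M.minor ^ 2 with hρ
  have hρ0 : 0 ≤ ρ := by nlinarith
  have hρ1 : ρ < 1 := by nlinarith
  obtain ⟨A, hA0, hA⟩ := exists_sq_mul_pow_le hρ0 hρ1 hε
  set r := M.minorVar v / √3 with hr
  have hr0 : 0 < r := by positivity
  refine ⟨1 + 3 * A / r ^ 2 + 12 * √(32 + A) / r ^ 2 + 2 * A / r + 16 * K / r ^ 3, ?_⟩
  intro N _ Q _ hQ s hs hvar z
  have hN : 1 ≤ N := NeZero.one_le
  have hN1 : (1 : ℝ) ≤ N := by exact_mod_cast hN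
  have hN0 : (0 : ℝ) < N := by linarith
  set t : ℝ := (N : ℝ) ^ ε with ht
  set w : ℝ := (N : ℝ) ^ (1 / 4 : ℝ) with hw
  have ht1 : 1 ≤ t := Real.one_le_rpow hN1 hε.le
  have htw : t ≤ w := Real.rpow_le_rpow_of_exponent_le hN1 hε'.le
  have hw0 : 0 < w := by linarith
  have hw4 : (N : ℝ) = w ^ 4 := by
    rw [hw, ← Real.rpow_natCast, ← Real.rpow_mul hN0.le]; norm_num
  have htw' : (N : ℝ) ^ (-(1 / 4 : ℝ) + ε) = t / w := by
    rw [neg_add_eq_sub, Real.rpow_sub hN0]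
  set k := ⌊t⌋₊ with hk
  have hk1 : 1 ≤ k := Nat.le_floor (by simpa using ht1)
  have hkt : (k : ℝ) ≤ t := Nat.floor_le (by linarith)
  set η := 4 * ρ ^ (k / 2) with hη
  have hη0 : 0 ≤ η := by positivity
  have hvb := isBdd_of_unit hv h0 h1
  have hvi : ∀ i, IsBdd fun y : Fin N → X => v (y i) := fun i =>
    ⟨hvb.1.comp (measurable_pi_apply i), hvb.2.imp fun C hC z => hC _⟩
  set e : Fin N → ℝ := fun i => ∫ y, v (y i) ∂Q with he
  have he0 : ∀ i, 0 ≤ e i := fun i => integral_nonneg fun y => h0 _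
  have he1 : ∀ i, e i ≤ 1 := fun i => by
    have := integral_mono ((hvi i).integrable Q) (integrable_const (1 : ℝ)) fun y => h1 (y i)
    simpa using this
  set Y : Fin N → (Fin N → X) → ℝ := fun i y => v (y i) - e i with hY
  have hYm : ∀ i, Measurable (Y i) := fun i => (hvi i).1.sub_const _
  have hY1 : ∀ i y, |Y i y| ≤ 1 := fun i y => by
    rw [abs_le]; constructor <;> simp only [hY] <;>
      linarith [h0 (y i), h1 (y i), he0 i, he1 i]
  have hYb : ∀ i, IsBdd (Y i) := fun i => IsBdd.of_le (hYm i) (hY1 i)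
  have hYY1 : ∀ i j y, |Y i y * Y j y| ≤ 1 := fun i j y => by
    rw [abs_mul]; exact mul_le_one₀ (hY1 i y) (abs_nonneg _) (hY1 j y)
  have hY0 : ∀ i, M.avg (Y i) = 0 := fun i => by
    rw [← hQ _ (hYb i)]
    simp only [hY]
    rw [integral_sub ((hvi i).integrable _) (integrable_const _)]
    simp [he]
  have hdep : ∀ i (u : Set (Fin N)), i ∈ u → DependsOn (Y i) u := fun i u hi x y hxy => by
    simp only [hY, hxy i hi]
  -- the local covariance bounds, from the decay of correlations
  have hmix1 : ∀ i (G : (Fin N → X) → ℝ), Measurable G → (∀ y, |G y| ≤ 1) →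
      DependsOn G ((cball i k : Set (Fin N))ᶜ) → |∫ y, Y i y * G y ∂Q| ≤ η := by
    intro i G hG hG1 hGd
    have := M.abs_avg_mul_sub_le (a := i) (l := 0) (n := k / 2) (hYm i) hG (hY1 i) hG1
      (hdep i _ (by simp [cball, cdist_self])) (hGd.mono fun x hx => by
        simp [cball] at hx ⊢; omega)
    rw [hY0, zero_mul, sub_zero] at this
    rw [hQ _ ((hYb i).mul (IsBdd.of_le hG hG1))]
    exact this
  have hl1 : ∀ i, ∀ φ : ℝ → ℝ, Measurable φ → (∀ x, |φ x| ≤ 1) →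
      |∫ y, Y i y * φ (∑ j ∈ (cball i k)ᶜ, Y j y) ∂Q| ≤ η := fun i φ hφ hφ1 =>
    hmix1 i _ (hφ.comp (Finset.measurable_sum _ fun j _ => hYm j)) (fun y => hφ1 _)
      fun x y hxy => congrArg φ (Finset.sum_congr rfl fun j hj =>
        hdep j _ (by simpa using hj) hxy)
  have hl2 : ∀ i, ∀ j ∉ cball i k, |∫ y, Y i y * Y j y ∂Q| ≤ η := fun i j hj =>
    hmix1 i _ (hYm j) (hY1 j) (hdep j _ (by simpa using hj))
  have hl3 : ∀ i l, l ∉ cball i (3 * k) → ∀ j ∈ cball i k, ∀ m ∈ cball l k,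
      |∫ y, (Y i y * Y j y) * (Y l y * Y m y) ∂Q
        - (∫ y, Y i y * Y j y ∂Q) * ∫ y, Y l y * Y m y ∂Q| ≤ η := by
    intro i l hl j hj m hm
    rw [mem_cball] at hl hj hm
    have hlm := cdist_triangle i m l
    rw [cdist_comm m l] at hlm
    rw [hQ _ (((hYb i).mul (hYb j)).mul ((hYb l).mul (hYb m))), hQ _ ((hYb i).mul (hYb j)),
      hQ _ ((hYb l).mul (hYb m))]
    refine M.abs_avg_mul_sub_le (a := i) (l := k) (n := k / 2) ((hYm i).mul (hYm j))
      ((hYm l).mul (hYm m)) (hYY1 i j) (hYY1 l m) ?_ ?_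
    · refine (dependsOn_mul (hdep i (cball i k : Set (Fin N)) ?_)
        (hdep j (cball i k : Set (Fin N)) ?_)).mono (by simp)
      · simp [cball, cdist_self]
      · simpa [cball] using hj
    · refine (dependsOn_mul (hdep l ((cball i (k + 2 * (k / 2)) : Set (Fin N))ᶜ) ?_)
        (hdep m ((cball i (k + 2 * (k / 2)) : Set (Fin N))ᶜ) ?_)).mono (by simp)
      · simp [cball]; omega
      · simp [cball]; omega
  have hvar' : s ^ 2 = ∫ y, (∑ i, Y i y) ^ 2 ∂Q := hvar
  have hsr : r * w ^ 2 ≤ s := by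
    refine le_of_sq_le_sq ?_ hs.le
    have hS : ∀ y : Fin N → X, ∑ i, Y i y = ∑ i, v (y i) - ∑ i, e i := fun y => by
      simp only [hY, Finset.sum_sub_distrib]
    have hSb : IsBdd fun y : Fin N → X => (∑ i, v (y i) - ∑ i, e i) ^ 2 := by
      have := (IsBdd.sum Finset.univ fun i _ => hvi i).sub (isBdd_const (∑ i, e i))
      simpa only [sq] using this.mul this
    rw [hvar']
    simp only [hS]
    rw [hQ _ hSb]
    refine le_trans (le_of_eq ?_) (M.le_avg_sq hv h0 h1 _)
    rw [mul_pow, ← pow_mul, ← hw4, hr, div_pow, Real.sq_sqrt (by norm_num)]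
    ring
  rw [htw']
  have hδ0 : 0 < t / w := by positivity
  have hδ1 : t / w ≤ 1 := div_le_one_of_le₀ htw hw0.le
  have hSb : IsBdd fun y => (∑ i, Y i y) / s := by
    simpa only [div_eq_inv_mul] using (IsBdd.sum Finset.univ fun i _ => hYb i).const_mul s⁻¹
  -- the windows `B i` are balls of radius `k`, and the larger neighbourhoods have radius `3 k`
  refine (hK Q _ hSb (t / w) _ hδ0 hδ1 (fun f f' hf hf2 hf3 hlip => ?_) z).trans
    (error_terms_le (s := s) (η := η) (n := (2 * (k + 1) : ℕ)) (n' := (2 * (3 * k + 1) : ℕ))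
      hr0 hA0 hK0 ht1 htw hw4 hsr (by positivity) ?_ ?_ hη0 (hA N hN))
  · have := abs_stein_discrepancy_le (P := Q) hYm hY1 (fun i => card_cball_le i k)
      (fun i => card_cball_le i (3 * k)) hη0 hs hvar' hl1 hl2 hl3 (by positivity) hf hf2 hf3 hlip
    rwa [Fintype.card_fin] at this
  · push_cast; linarith
  · push_cast; linarith

end Model

/-! ### The Coulomb chain -/

variable {β γ : ℝ}

/-- The model of the Coulomb chain over the uniform law on `[0, 1]`. The weights are those of the
Gibbs law on the positive half line. Elsewhere they are set to `1`: with the convention `γ / 0 = 0`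
and `γ > 0`, the formula for `floor` would exceed the bond weight at `0`. -/
def coulomb (hβ : 0 < β) (hγ : 0 ≤ γ) : Model ℝ where
  ν := volume.restrict (Set.Icc 0 1)
  prob := ⟨by simp⟩
  site x := if 0 < x then Real.exp (-(β / (2 * x))) else 1
  bond x y := if 0 < x ∧ 0 < y then Real.exp (-(γ / (x + y))) else 1
  floor x := if 0 < x then Real.exp (-(γ / x)) else 1
  measurable_site := Measurable.ite measurableSet_Ioi (by fun_prop) measurable_const
  measurable_bond := by
    have h : MeasurableSet {p : ℝ × ℝ | 0 < p.1 ∧ 0 < p.2} :=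
      (measurableSet_lt measurable_const measurable_fst).inter
        (measurableSet_lt measurable_const measurable_snd)
    exact Measurable.ite h (by fun_prop) measurable_const
  measurable_floor := Measurable.ite measurableSet_Ioi (by fun_prop) measurable_const
  site_pos x := by split_ifs <;> positivity
  site_le x := by
    split_ifs with h
    · exact Real.exp_le_one_iff.2 (neg_nonpos.2 (by positivity))
    · exact le_rfl
  floor_pos x := by split_ifs <;> positivity
  floor_le x := by
    split_ifs with h
    · exact Real.exp_le_one_iff.2 (neg_nonpos.2 (by positivity))
    · exact le_rfl
  bond_le x y := by
    split_ifs with h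
    · obtain ⟨hx, hy⟩ := h
      exact Real.exp_le_one_iff.2 (neg_nonpos.2 (by positivity))
    · exact le_rfl
  floor_le_left x y := by
    by_cases hx : 0 < x <;> by_cases hy : 0 < y
    · simp only [hx, hy, and_self, if_true]
      gcongr
      linarith
    · simpa [hx, hy] using div_nonneg hγ hx.le
    · simp [hx]
    · simp [hx]
  floor_le_right x y := by
    by_cases hx : 0 < x <;> by_cases hy : 0 < y
    · simp only [hx, hy, and_self, if_true]
      gcongr
      linarith
    · simp [hy]
    · simpa [hx, hy] using div_nonneg hγ hy.le
    · simp [hy]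

/-- The spin as a bounded observable: the identity on `[0, 1]`. -/
def clamp (x : ℝ) : ℝ := max 0 (min x 1)

theorem measurable_clamp : Measurable clamp :=
  measurable_const.max (measurable_id.min measurable_const)

theorem clamp_nonneg (x : ℝ) : 0 ≤ clamp x := le_max_left _ _

theorem clamp_le_one (x : ℝ) : clamp x ≤ 1 := max_le zero_le_one (min_le_right _ _)

theorem clamp_of_mem {x : ℝ} (h : x ∈ Set.Icc (0 : ℝ) 1) : clamp x = x := by
  simp [clamp, h.1, h.2]

theorem minorVar_coulomb_pos (hβ : 0 < β) (hγ : 0 ≤ γ) : 0 < (coulomb hβ hγ).minorVar clamp := by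
  set M := coulomb hβ hγ
  have hw : ∀ x, 0 < M.site x * M.floor x ^ 2 := fun x =>
    mul_pos (M.site_pos x) (pow_pos (M.floor_pos x) 2)
  have hnn : ∀ x, 0 ≤ M.site x * M.floor x ^ 2 * (clamp x - M.minorMean clamp) ^ 2 := fun x =>
    mul_nonneg (hw x).le (sq_nonneg _)
  have hc := (isBdd_of_unit measurable_clamp clamp_nonneg clamp_le_one).sub
    (isBdd_const (M.minorMean clamp))
  refine lt_of_le_of_ne (integral_nonneg hnn) fun h => ?_
  have h1 := (integral_eq_zero_iff_of_nonneg hnn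
    ((M.isBdd_minor.mul (by simpa only [sq] using hc.mul hc)).integrable _)).1 h.symm
  -- otherwise the identity would be constant on `[0, 1]`
  have h2 : ∀ᵐ x ∂M.ν, x ∈ Set.Icc (0 : ℝ) 1 := ae_restrict_mem measurableSet_Icc
  have h3 : ∀ᵐ x ∂M.ν, x ≠ M.minorMean clamp :=
    ae_restrict_of_ae (Measure.ae_ne volume (M.minorMean clamp))
  obtain ⟨x, hx1, hx2, hx3⟩ := (h1.and (h2.and h3)).exists
  have h4 := (mul_eq_zero.1 hx1).resolve_left (hw x).ne'
  rw [clamp_of_mem hx2] at h4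
  exact hx3 (sub_eq_zero.1 (pow_eq_zero_iff two_ne_zero |>.1 h4))

variable {N : ℕ} [NeZero N]

theorem volume_restrict_cube (hβ : 0 < β) (hγ : 0 ≤ γ) :
    (volume.restrict (Set.Icc (0 : Fin N → ℝ) 1)) = (coulomb hβ hγ).ref N := by
  have h : (volume : Measure (Fin N → ℝ)) = Measure.pi fun _ => volume := volume_pi
  rw [← Set.pi_univ_Icc, h]
  exact Measure.restrict_pi_pi _ _

theorem ae_mem_unit (hβ : 0 < β) (hγ : 0 ≤ γ) :
    ∀ᵐ y ∂(coulomb hβ hγ).ref N, ∀ i, 0 < y i ∧ y i ∈ Set.Icc (0 : ℝ) 1 := by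
  refine ae_all_iff.2 fun i => ?_
  refine Measure.tendsto_eval_ae_ae.eventually (p := fun x => 0 < x ∧ x ∈ Set.Icc (0 : ℝ) 1) ?_
  have h2 : ∀ᵐ x ∂(coulomb hβ hγ).ν, x ∈ Set.Icc (0 : ℝ) 1 := ae_restrict_mem measurableSet_Icc
  have h3 : ∀ᵐ x ∂(coulomb hβ hγ).ν, x ≠ 0 := ae_restrict_of_ae (Measure.ae_ne volume 0)
  filter_upwards [h2, h3] with x hx hx0
  exact ⟨lt_of_le_of_ne hx.1 (Ne.symm hx0), hx⟩

theorem exp_neg_energy (hβ : 0 < β) (hγ : 0 ≤ γ) {y : Fin N → ℝ} (hy : ∀ i, 0 < y i) :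
    Real.exp (-energy β γ N y) = (coulomb hβ hγ).wt Finset.univ y := by
  have h : touch (Finset.univ : Finset (Fin N)) = Finset.univ := by simp [touch]
  rw [Model.wt, h, Model.siteProd, Model.bondProd, ← Finset.prod_mul_distrib, energy,
    ← Finset.sum_neg_distrib, Real.exp_sum]
  refine Finset.prod_congr rfl fun i _ => ?_
  simp only [coulomb, hy, and_self, if_true]
  rw [← Real.exp_add]
  congr 1; ring

theorem partitionFunction_eq (hβ : 0 < β) (hγ : 0 ≤ γ) :
    partitionFunction β γ N = (coulomb hβ hγ).part N := by
  rw [partitionFunction, volume_restrict_cube hβ hγ]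
  refine integral_congr_ae ?_
  filter_upwards [ae_mem_unit hβ hγ] with y hy
  exact exp_neg_energy hβ hγ fun i => (hy i).1

theorem integral_law (hβ : 0 < β) (hγ : 0 ≤ γ) (φ : (Fin N → ℝ) → ℝ) :
    ∫ y, φ y ∂(law β γ N) = (coulomb hβ hγ).avg φ := by
  have hm : Measurable fun y : Fin N → ℝ => ENNReal.ofReal (density β γ N y) := by
    unfold density energy; fun_prop
  rw [law, integral_withDensity_eq_integral_toReal_smul hm
    (Filter.Eventually.of_forall fun y => ENNReal.ofReal_lt_top), volume_restrict_cube hβ hγ,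
    Model.avg_def, ← partitionFunction_eq, div_eq_inv_mul, ← integral_const_mul]
  have hZ : 0 < partitionFunction β γ N := by
    rw [partitionFunction_eq hβ hγ]; exact Model.part_pos _
  refine integral_congr_ae ?_
  filter_upwards [ae_mem_unit hβ hγ] with y hy
  have hd : 0 ≤ density β γ N y := by unfold density; positivity
  rw [ENNReal.toReal_ofReal hd, density, exp_neg_energy hβ hγ fun i => (hy i).1, smul_eq_mul]
  ring

theorem ae_law_mem_unit (hβ : 0 < β) (hγ : 0 ≤ γ) :
    ∀ᵐ y ∂(law β γ N), ∀ i, y i ∈ Set.Icc (0 : ℝ) 1 := by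
  have h : law β γ N ≪ (coulomb hβ hγ).ref N := by
    rw [← volume_restrict_cube hβ hγ]
    exact withDensity_absolutelyContinuous _ _
  filter_upwards [h.ae_le (ae_mem_unit hβ hγ)] with y hy i
  exact (hy i).2

end CoulombChain

end

theorem mainTheorem2 (β γ : ℝ) (hβ : 0 < β) (hγ : 0 ≤ γ) (ε : ℝ) (hε : 0 < ε)
    (hε' : ε < 1 / 4) :
    ∃ C : ℝ, ∀ (N : ℕ) [NeZero N] (Ω : Type*) [MeasurableSpace Ω] (P : Measure Ω)
      [IsProbabilityMeasure P] (Y : Ω → Fin N → ℝ), HasLaw Y (CoulombChain.law β γ N) P →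
        0 < CoulombChain.sigmaSq P Y ∧
        ∀ z : ℝ, |P.real {ω | CoulombChain.zeta P Y ω ≤ z} -
            (gaussianReal 0 1).real (Set.Iic z)| ≤ C * (N : ℝ) ^ (-(1 / 4 : ℝ) + ε) := by
  open CoulombChain in
  have hV := minorVar_coulomb_pos hβ hγ
  obtain ⟨C, hC⟩ := (coulomb hβ hγ).exists_berry_esseen measurable_clamp clamp_nonneg clamp_le_one
    hV hε hε'
  refine ⟨C, fun N _ Ω _ P _ Y hY => ?_⟩
  have hN0 : (0 : ℝ) < N := by exact_mod_cast NeZero.pos N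
  set Q := law β γ N with hQ
  have hQp : IsProbabilityMeasure Q := isProbabilityMeasure_law hβ hγ N
  have hunit : ∀ᵐ y ∂Q, ∀ i, y i ∈ Set.Icc (0 : ℝ) 1 := ae_law_mem_unit hβ hγ
  have hmean : ∀ i, ∫ ω, Y ω i ∂P = ∫ y, clamp (y i) ∂Q := fun i => by
    have h1 : ∫ ω, Y ω i ∂P = ∫ y, y i ∂Q :=
      hY.integral_comp (f := fun y : Fin N → ℝ => y i)
        (measurable_pi_apply i).aestronglyMeasurable
    rw [h1]
    refine integral_congr_ae ?_
    filter_upwards [hunit] with y hy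
    exact (clamp_of_mem (hy i)).symm
  set S : (Fin N → ℝ) → ℝ := fun y => ∑ i, (y i - ∫ y', clamp (y' i) ∂Q) with hS
  set S' : (Fin N → ℝ) → ℝ := fun y => ∑ i, (clamp (y i) - ∫ y', clamp (y' i) ∂Q) with hS'
  have hSm : Measurable S := by fun_prop
  have hcs : centredSum P Y = S ∘ Y := by
    funext ω
    simp only [centredSum, hmean, hS, Function.comp]
  have hSS' : S =ᵐ[Q] S' := by
    filter_upwards [hunit] with y hy
    exact Finset.sum_congr rfl fun i _ => by rw [clamp_of_mem (hy i)]
  have hcl : ∀ i, IsBdd fun y : Fin N → ℝ => clamp (y i) := fun i =>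
    isBdd_of_unit (measurable_clamp.comp (measurable_pi_apply i)) (fun y => clamp_nonneg _)
      fun y => clamp_le_one _
  have hS'b : IsBdd S' := IsBdd.sum _ fun i _ => (hcl i).sub (isBdd_const _)
  have hS'0 : ∫ y, S' y ∂Q = 0 := by
    simp only [hS']
    rw [integral_finsetSum _ fun i _ => ((hcl i).sub (isBdd_const _)).integrable _]
    refine Finset.sum_eq_zero fun i _ => ?_
    rw [integral_sub ((hcl i).integrable _) (integrable_const _)]
    simp
  have hvar : variance (centredSum P Y) P = ∫ y, S' y ^ 2 ∂Q := by
    rw [hcs, ← variance_map (by rw [hY.map_eq]; exact hSm.aemeasurable) hY.aemeasurable, hY.map_eq,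
      variance_congr hSS', variance_eq_integral hS'b.1.aemeasurable, hS'0]
    simp
  have hpos : 0 < ∫ y, S' y ^ 2 ∂Q := by
    have h1 := (coulomb hβ hγ).le_avg_sq (N := N) measurable_clamp clamp_nonneg clamp_le_one
      (∑ i, ∫ y', clamp (y' i) ∂Q)
    have h2 : ∀ y, S' y = ∑ i, clamp (y i) - ∑ i, ∫ y', clamp (y' i) ∂Q := fun y => by
      simp only [hS', Finset.sum_sub_distrib]
    simp only [h2]
    rw [hQ, integral_law hβ hγ]
    exact lt_of_lt_of_le (by positivity) h1
  have hsig : (N : ℝ) * sigmaSq P Y = ∫ y, S' y ^ 2 ∂Q := by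
    rw [sigmaSq, hvar]; field_simp
  refine ⟨?_, fun z => ?_⟩
  · rw [sigmaSq, hvar]; positivity
  have h := hC N Q (fun φ _ => integral_law hβ hγ φ) (√(∫ y, S' y ^ 2 ∂Q)) (Real.sqrt_pos.2 hpos)
    (Real.sq_sqrt hpos.le) z
  have hset : P.real {ω | zeta P Y ω ≤ z} = Q.real {y | S' y / √(∫ y, S' y ^ 2 ∂Q) ≤ z} := by
    have h1 : {ω | zeta P Y ω ≤ z} = {ω | S (Y ω) / √(∫ y, S' y ^ 2 ∂Q) ≤ z} := by
      ext ω
      simp only [zeta, hsig, hcs, Function.comp, Set.mem_ofPred_eq, div_eq_inv_mul, mul_one]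
    rw [h1, hY.measureReal_eq (p := fun y => S y / √(∫ y, S' y ^ 2 ∂Q) ≤ z)
      (measurableSet_le (hSm.div_const _) measurable_const)]
    refine measureReal_congr ?_
    filter_upwards [hSS'] with y hy
    exact congrArg (fun a => a / √(∫ y, S' y ^ 2 ∂Q) ≤ z) hy
  rw [hset]
  exact h
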